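/- **Encoders and transfer functions.** A rate-$1/2$ recursive systematic convolutional encoder is given by a generator matrix $(1, b(D)/a(D))$ over $\mathbb F_2$ with $\gcd(a,b)=1$, $a(0)=1$ and $a\neq 1$; its trellis has the $2^\nu$ states of the controller canonical form, $\nu=\max(\deg a,\deg b)$. For input erasure probabilities $p_1$ (systematic bit) and $p_2$ (parity bit), let $f_{\mathrm s}(p_1,p_2)$ be the transfer function of its BCJR decoder on the binary erasure channel for the systematic bit, that is, the extrinsic erasure probability $\pi_\alpha T\pi_\beta$ of the systematic bit when the forward and backward metric vectors are independent and in the steady state of their Markov chains (the limit law of the chains started from the known zero state). Let $f_{\mathrm{U,s}}$ and $f_{\mathrm{L,s}}$ be the transfer functions of two such encoders, possibly different (upper and lower encoder). **Uncoupled ensemble.** Consider the parallel concatenated code (PCC) with these encoders, whose information bits, upper parity bits and lower parity bits are randomly punctured with permeability rates $\rho_0\in[0,1]$, $\rho_1\in(0,1]$, $\rho_2\in(0,1]$; put $\varepsilon_\rho=1-(1-\varepsilon)\rho$. Its density evolution (DE) recursion for the extrinsic erasure probabilities $x=(x_1,x_2)$ of the information bits at the output of the upper and lower decoder is $x_1\leftarrow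 f_{\mathrm{U,s}}(\varepsilon_{\rho_0}x_2,\varepsilon_{\rho_1})$, $x_2\leftarrow f_{\mathrm{L,s}}(\varepsilon_{\rho_0}x_1,\varepsilon_{\rho_2})$. Then: 1. The recursion is $x\leftarrow f(g(x);\varepsilon)$ with $f(x;\varepsilon)=(f_{\mathrm{U,s}}(\varepsilon_{\rho_0}x_1,\varepsilon_{\rho_1}),f_{\mathrm{L,s}}(\varepsilon_{\rho_0}x_2,\varepsilon_{\rho_2}))$ and $g(x)=(x_2,x_1)$. 2. $(f,g)$ is a vector admissible system on $[0,1]^2$ for $\varepsilon\in E$, where $E=[0,1)$ if $\rho_0>0$ and $E=(0,1)$ if $\rho_0=0$, with $D=I_{2\times2}$, $G(x)=x_1x_2$ and $F(x;\varepsilon)=\int_0^{x_1}f_{\mathrm{U,s}}(\varepsilon_{\rho_0}z,\varepsilon_{\rho_1})\,dz+\int_0^{x_2}f_{\mathrm{L,s}}(\varepsilon_{\rho_0}z,\varepsilon_{\rho_2})\,dz$. This means: $D$ is diagonal with positive entries; $f$ maps $[0,1]^2\times E$ to $[0,1]^2$ and $g$ maps $[0,1]^2$ to itself; $f$ and $g$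 are twice continuously differentiable (jointly in $x$ and $\varepsilon$) and nondecreasing in $x$ and $\varepsilon$ (componentwise order); $F'(x;\varepsilon)=f(x;\varepsilon)D$ and $G'(x)=g(x)D$ (gradients in $x$); $f(g(0);\varepsilon)=0$, $F(g(0);\varepsilon)=0$ and $G(0)=0$. 3. The potential function $U(x;\varepsilon)=\int (z-f(g(z);\varepsilon))\,D\,g'(z)\cdot dz$ is well defined for every $\varepsilon\in[0,1)$: along every $C^1$ path in $[0,1]^2$ from $0$ to $x$ the integral exists and equals $g(x)Dx^{\mathsf T}-G(x)-F(g(x);\varepsilon)$. **Coupled ensemble.** Consider the spatially coupled PCC (SC-PCC) ensemble with coupling memory $m$ and coupling length $L$ and the same puncturing: the information sequence $u_t$ ($1\le t\le L$) is connected to the upper and lower trellises at times $t,\dots,t+m$; all information sequences at times outside $1,\dots,L$ and all parity sequences at times outside $1,\dots,L$ are known. Its DE recursion, for the extrinsic erasure probabilities $p_{\mathrm{U,s}}^{(t)},p_{\mathrm{L,s}}^{(t)}$ of the information bits at the outputs of the trellises, with all initial values $1$, is $$\bar q_{\mathrm c}^{(t)}=\frac1{m+1}\sum_{j=0}^m p_{\mathrm{c,s}}^{(t+j)}\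 (1\le t\le L),\qquad \bar q_{\mathrm c}^{(t)}=0\ \text{otherwise},\qquad q_{\mathrm c}^{(t)}=\frac{\varepsilon_{\rho_0}}{m+1}\sum_{k=0}^m\bar q_{\mathrm c}^{(t-k)}\qquad(\mathrm c=\mathrm U,\mathrm L),$$ $$p_{\mathrm{U,s}}^{(t)}\leftarrow f_{\mathrm{U,s}}(q_{\mathrm L}^{(t)},\varepsilon_{\rho_1}),\qquad p_{\mathrm{L,s}}^{(t)}\leftarrow f_{\mathrm{L,s}}(q_{\mathrm U}^{(t)},\varepsilon_{\rho_2})\qquad(1\le t\le L),$$ where at other times the second arguments are $0$; the a-posteriori erasure probability is $\varepsilon_{\rho_0}\bar q_{\mathrm U}^{(t)}\bar q_{\mathrm L}^{(t)}$. Then: 4. For $x_t=(\bar q_{\mathrm U}^{(t)},\bar q_{\mathrm L}^{(t)})$ this is the coupled vector recursion $$x_t\leftarrow\frac1{m+1}\sum_{j=0}^m f_{t+j}\Big(\frac1{m+1}\sum_{k=0}^m g(x_{t+j-k})\Big)\quad(1\le t\le L),\qquad x_t=0\ \text{otherwise},$$ where $f_t=f(\cdot\,;\varepsilon)$ for $1\le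 t\le L$ and, at other times, $f_t(x)=(f_{\mathrm{U,s}}(\varepsilon_{\rho_0}x_1,0),f_{\mathrm{L,s}}(\varepsilon_{\rho_0}x_2,0))$. 5. (Threshold saturation.) Let $\Delta E(\varepsilon)$ be the infimum of $U(x;\varepsilon)$ over the nonzero fixed points $x=f(g(x);\varepsilon)$ in $[0,1]^2$ ($+\infty$ if there are none), and let $\varepsilon^*=\sup\{\varepsilon\in[0,1):\Delta E(\varepsilon)>0\}$ be the potential threshold ($0$ if the set is empty). For every $\varepsilon\in[0,1)$ with $\varepsilon<\varepsilon^*$ there is an $m_0$ such that for all $m\ge m_0$ and all $L$ the only fixed point of the SC-PCC DE recursion with values in $[0,1]$ is $0$, and all extrinsic and all a-posteriori erasure probabilities of the information bits converge to $0$ as the number of iterations tends to infinity. -/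

import Mathlib

open Set Filter Topology Matrix Polynomial

noncomputable section

/-! ### Recursive systematic convolutional encoders of rate 1/2 and their trellis -/

/-- A rate-1/2 recursive systematic convolutional encoder with generator matrix `(1, num / den)`.
The fraction is reduced, the denominator has constant term `1` (causality), and it is not the
constant `1` (otherwise the encoder would be feedforward, not recursive). -/
structure RSCEncoder where
  num : (ZMod 2)[X]
  den : (ZMod 2)[X]
  den_coeff_zero : den.coeff 0 = 1
  coprime : IsCoprime num den
  recursive : den ≠ 1

namespace RSCEncoder

/-- The memory of the encoder. -/
def memory (C : RSCEncoder) : ℕ := max C.num.natDegree C.den.natDegree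

/-- The states of the controller canonical form: the contents of the shift register,
most recent symbol first. There are `2 ^ memory` of them. -/
abbrev State (C : RSCEncoder) : Type := Fin C.memory → ZMod 2

/-- The symbol fed into the shift register in state `s` with input bit `u`. -/
def registerInput (C : RSCEncoder) (s : C.State) (u : ZMod 2) : ZMod 2 :=
  u + ∑ i : Fin C.memory, C.den.coeff (i + 1) * s i

/-- The end state of the trellis edge that leaves state `s` with input bit `u`. -/
def nextState (C : RSCEncoder) (s : C.State) (u : ZMod 2) : C.State := fun i =>
  if (i : ℕ) = 0 then C.registerInput s u
  else s ⟨(i : ℕ) - 1, lt_of_le_of_lt (Nat.sub_le _ _) i.isLt⟩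

/-- The two code bits on the trellis edge that leaves state `s` with input bit `u`:
bit `0` is the systematic bit and bit `1` is the parity bit. -/
def codeBit (C : RSCEncoder) (s : C.State) (u : ZMod 2) : Fin 2 → ZMod 2 :=
  ![u, C.num.coeff 0 * C.registerInput s u
      + ∑ i : Fin C.memory, C.num.coeff (i + 1) * s i]

/-! ### The BCJR decoder on the binary erasure channel

The all-zero codeword is transmitted. An erasure pattern of one trellis section is a map
`e : Fin 2 → Bool`, where `e l = true` means that code bit `l` is erased. The nonzero entries of a
forward or backward metric vector are equal and are normalized to `1`, so that a metric vector is
the finite set of the states at which it is nonzero. -/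

/-- The edge `(s, u)` agrees with all unerased (hence zero) received code bits. -/
def Compatible (C : RSCEncoder) (e : Fin 2 → Bool) (s : C.State) (u : ZMod 2) : Prop :=
  ∀ l, e l = false → C.codeBit s u l = 0

open Classical in
/-- One step of the forward recursion for the metric vector. -/
def forwardStep (C : RSCEncoder) (e : Fin 2 → Bool) (A : Finset C.State) : Finset C.State :=
  Finset.univ.filter fun s => ∃ s' ∈ A, ∃ u, C.nextState s' u = s ∧ C.Compatible e s' u

open Classical in
/-- One step of the backward recursion for the metric vector. -/
def backwardStep (C : RSCEncoder) (e : Fin 2 → Bool) (B : Finset C.State) : Finset C.State :=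
  Finset.univ.filter fun s' => ∃ u, C.nextState s' u ∈ B ∧ C.Compatible e s' u

end RSCEncoder

/-- The probability of the erasure pattern `e` if code bit `l` is erased with probability `p l`,
independently of the other one. -/
def erasureWeight (p : Fin 2 → ℝ) (e : Fin 2 → Bool) : ℝ :=
  ∏ l, if e l = true then p l else 1 - p l

open Classical in
/-- The transition matrix of the Markov chain of metric vectors that is driven by independent
erasure patterns: the entry `(B, A)` is the probability of a transition from `A` to `B`. -/
def metricTransition {S : Type} [Fintype S] (step : (Fin 2 → Bool) → Finset S → Finset S)
    (p : Fin 2 → ℝ) : Matrix (Finset S) (Finset S) ℝ :=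
  fun B A => ∑ e, if step e A = B then erasureWeight p e else 0

open Classical in
/-- The law of the metric vector after `n` trellis sections, starting from the known state `z`. -/
def metricLaw {S : Type} [Fintype S] (step : (Fin 2 → Bool) → Finset S → Finset S)
    (z : S) (p : Fin 2 → ℝ) (n : ℕ) : Finset S → ℝ :=
  (metricTransition step p ^ n) *ᵥ Pi.single {z} 1

/-- The steady-state law of the chain of metric vectors: the limit of the law as the known initial
state recedes (it exists and is stationary, as shown below). -/
def steadyState {S : Type} [Fintype S] (step : (Fin 2 → Bool) → Finset S → Finset S)
    (z : S) (p : Fin 2 → ℝ) : Finset S → ℝ :=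
  fun A => limUnder atTop fun n => metricLaw step z p n A

theorem erasureWeight_nonneg {p : Fin 2 → ℝ} (hp : ∀ l, p l ∈ Icc (0 : ℝ) 1) (e : Fin 2 → Bool) :
    0 ≤ erasureWeight p e := by
  refine Finset.prod_nonneg fun l _ => ?_
  split_ifs
  · exact (hp l).1
  · linarith [(hp l).2]

theorem sum_erasureWeight (p : Fin 2 → ℝ) : ∑ e, erasureWeight p e = 1 := by
  have h := Finset.prod_univ_sum (fun _ : Fin 2 => (Finset.univ : Finset Bool))
    (fun l b => if b = true then p l else 1 - p l)
  rw [Fintype.piFinset_univ] at h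
  simp only [erasureWeight]
  rw [← h]
  simp

theorem vecMul_metricTransition {S : Type} [Fintype S]
    (step : (Fin 2 → Bool) → Finset S → Finset S) (p : Fin 2 → ℝ) (h : Finset S → ℝ)
    (A : Finset S) :
    (h ᵥ* metricTransition step p) A = ∑ e, erasureWeight p e * h (step e A) := by
  simp only [Matrix.vecMul, dotProduct, metricTransition, Finset.mul_sum]
  rw [Finset.sum_comm]
  refine Finset.sum_congr rfl fun e _ => ?_
  simp [mul_comm]

/-- Expectations of monotone functions of the metric vector converge as the known initial state
recedes. -/
theorem exists_tendsto_dotProduct_metricLaw {S : Type} [Fintype S]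
    {step : (Fin 2 → Bool) → Finset S → Finset S} {z : S} {p : Fin 2 → ℝ}
    (hmono : ∀ e, Monotone (step e)) (hz : ∀ e, z ∈ step e {z})
    (hp : ∀ l, p l ∈ Icc (0 : ℝ) 1) {h : Finset S → ℝ} (hh : Monotone h) :
    ∃ a, Tendsto (fun n => h ⬝ᵥ metricLaw step z p n) atTop (𝓝 a) := by
  classical
  have key : ∀ n, h ⬝ᵥ metricLaw step z p n = (h ᵥ* metricTransition step p ^ n) {z} := by
    intro n
    simp only [metricLaw]
    rw [Matrix.dotProduct_mulVec]
    simp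
  have hM : ∀ n, Monotone (h ᵥ* metricTransition step p ^ n) ∧
      ∀ A, (h ᵥ* metricTransition step p ^ n) A ≤ h Finset.univ := by
    intro n
    induction n with
    | zero => simpa using ⟨hh, fun A => hh (Finset.subset_univ A)⟩
    | succ n ih =>
      rw [pow_succ, ← Matrix.vecMul_vecMul]
      refine ⟨fun A B hAB => ?_, fun A => ?_⟩
      · rw [vecMul_metricTransition, vecMul_metricTransition]
        exact Finset.sum_le_sum fun e _ =>
          mul_le_mul_of_nonneg_left (ih.1 (hmono e hAB)) (erasureWeight_nonneg hp e)
      · rw [vecMul_metricTransition]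
        calc _ ≤ ∑ e, erasureWeight p e * h Finset.univ := Finset.sum_le_sum fun e _ =>
              mul_le_mul_of_nonneg_left (ih.2 _) (erasureWeight_nonneg hp e)
          _ = h Finset.univ := by rw [← Finset.sum_mul, sum_erasureWeight, one_mul]
  refine ⟨_, tendsto_atTop_ciSup (monotone_nat_of_le_succ fun n => ?_)
    ⟨h Finset.univ, ?_⟩⟩
  · rw [key, key, pow_succ, ← Matrix.vecMul_vecMul, vecMul_metricTransition]
    calc _ = ∑ e, erasureWeight p e * (h ᵥ* metricTransition step p ^ n) {z} := by
          rw [← Finset.sum_mul, sum_erasureWeight, one_mul]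
      _ ≤ _ := Finset.sum_le_sum fun e _ => mul_le_mul_of_nonneg_left
          ((hM n).1 (Finset.singleton_subset_iff.2 (hz e))) (erasureWeight_nonneg hp e)
  · rintro _ ⟨n, rfl⟩
    simp only [key]
    exact (hM n).2 _

/-- The law of the metric vector converges to the steady state. -/
theorem tendsto_metricLaw {S : Type} [Fintype S]
    {step : (Fin 2 → Bool) → Finset S → Finset S} {z : S} {p : Fin 2 → ℝ}
    (hmono : ∀ e, Monotone (step e)) (hz : ∀ e, z ∈ step e {z})
    (hp : ∀ l, p l ∈ Icc (0 : ℝ) 1) :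
    Tendsto (metricLaw step z p) atTop (𝓝 (steadyState step z p)) := by
  classical
  refine tendsto_pi_nhds.2 fun A => ?_
  have h₁ : Monotone fun B : Finset S => if A ⊆ B then (1 : ℝ) else 0 := by
    intro B B' hB
    dsimp only
    split_ifs with h h' h'
    · exact le_rfl
    · exact absurd (h.trans hB) h'
    · exact zero_le_one
    · exact le_rfl
  have h₂ : Monotone fun B : Finset S => if A ⊂ B then (1 : ℝ) else 0 := by
    intro B B' hB
    dsimp only
    split_ifs with h h' h'
    · exact le_rfl
    · exact absurd (h.trans_subset hB) h'
    · exact zero_le_one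
    · exact le_rfl
  obtain ⟨a, ha⟩ := exists_tendsto_dotProduct_metricLaw hmono hz hp h₁
  obtain ⟨b, hb⟩ := exists_tendsto_dotProduct_metricLaw hmono hz hp h₂
  refine tendsto_nhds_limUnder ⟨a - b, (ha.sub hb).congr fun n => ?_⟩
  simp only [dotProduct]
  rw [← Finset.sum_sub_distrib]
  have hsum : ∀ B, (if A ⊆ B then (1 : ℝ) else 0) * metricLaw step z p n B
      - (if A ⊂ B then (1 : ℝ) else 0) * metricLaw step z p n B
      = if A = B then metricLaw step z p n B else 0 := by
    intro B
    by_cases hB : A = B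
    · subst hB
      simp
    · by_cases hs : A ⊆ B
      · simp [hB, hs, hs.ssubset_of_ne hB]
      · have : ¬ A ⊂ B := fun h => hs h.subset
        simp [hB, hs, this]
  rw [Finset.sum_congr rfl fun B _ => hsum B]
  simp

/-- The steady state is a stationary law of the chain of metric vectors. -/
theorem metricTransition_mulVec_steadyState {S : Type} [Fintype S]
    {step : (Fin 2 → Bool) → Finset S → Finset S} {z : S} {p : Fin 2 → ℝ}
    (hmono : ∀ e, Monotone (step e)) (hz : ∀ e, z ∈ step e {z})
    (hp : ∀ l, p l ∈ Icc (0 : ℝ) 1) :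
    metricTransition step p *ᵥ steadyState step z p = steadyState step z p := by
  classical
  have h := tendsto_metricLaw hmono hz hp
  have hc : Continuous fun v : Finset S → ℝ => metricTransition step p *ᵥ v :=
    continuous_const.matrix_mulVec continuous_id
  refine tendsto_nhds_unique ((hc.tendsto _).comp h)
    (((tendsto_add_atTop_iff_nat 1).2 h).congr fun n => ?_)
  simp only [metricLaw, Function.comp]
  rw [Matrix.mulVec_mulVec, pow_succ']

namespace RSCEncoder

/-- The steady-state law of the forward metric vectors. -/
def forwardLaw (C : RSCEncoder) (p : Fin 2 → ℝ) : Finset C.State → ℝ :=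
  steadyState C.forwardStep 0 p

/-- The steady-state law of the backward metric vectors. -/
def backwardLaw (C : RSCEncoder) (p : Fin 2 → ℝ) : Finset C.State → ℝ :=
  steadyState C.backwardStep 0 p

theorem forwardStep_mono (C : RSCEncoder) (e : Fin 2 → Bool) : Monotone (C.forwardStep e) := by
  intro A B h s hs
  simp only [forwardStep, Finset.mem_filter, Finset.mem_univ, true_and] at hs ⊢
  obtain ⟨s', hs', r⟩ := hs
  exact ⟨s', h hs', r⟩

theorem backwardStep_mono (C : RSCEncoder) (e : Fin 2 → Bool) : Monotone (C.backwardStep e) := by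
  intro A B h s hs
  simp only [backwardStep, Finset.mem_filter, Finset.mem_univ, true_and] at hs ⊢
  obtain ⟨u, hu, r⟩ := hs
  exact ⟨u, h hu, r⟩

theorem nextState_zero (C : RSCEncoder) : C.nextState 0 0 = 0 := by
  funext i
  simp [nextState, registerInput]

theorem compatible_zero (C : RSCEncoder) (e : Fin 2 → Bool) : C.Compatible e 0 0 := by
  intro l _
  fin_cases l <;> simp [codeBit, registerInput]

theorem zero_mem_forwardStep (C : RSCEncoder) (e : Fin 2 → Bool) : 0 ∈ C.forwardStep e {0} := by
  simp only [forwardStep, Finset.mem_filter, Finset.mem_univ, true_and]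
  exact ⟨0, by simp, 0, C.nextState_zero, C.compatible_zero e⟩

theorem zero_mem_backwardStep (C : RSCEncoder) (e : Fin 2 → Bool) : 0 ∈ C.backwardStep e {0} := by
  simp only [backwardStep, Finset.mem_filter, Finset.mem_univ, true_and]
  exact ⟨0, by simp [C.nextState_zero], C.compatible_zero e⟩

theorem tendsto_forwardLaw (C : RSCEncoder) {p : Fin 2 → ℝ} (hp : ∀ l, p l ∈ Icc (0 : ℝ) 1) :
    Tendsto (metricLaw C.forwardStep 0 p) atTop (𝓝 (C.forwardLaw p)) :=
  tendsto_metricLaw C.forwardStep_mono C.zero_mem_forwardStep hp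

theorem tendsto_backwardLaw (C : RSCEncoder) {p : Fin 2 → ℝ} (hp : ∀ l, p l ∈ Icc (0 : ℝ) 1) :
    Tendsto (metricLaw C.backwardStep 0 p) atTop (𝓝 (C.backwardLaw p)) :=
  tendsto_metricLaw C.backwardStep_mono C.zero_mem_backwardStep hp

/-- With forward metric `A`, backward metric `B` and erasure pattern `e`, code bit `l` remains
undetermined from the other observations: both of its values occur on trellis edges from `A` to `B`
that agree with the unerased code bits other than `l`, so its extrinsic likelihood ratio is `1`. -/
def Undetermined (C : RSCEncoder) (l : Fin 2) (A B : Finset C.State) (e : Fin 2 → Bool) : Prop :=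
  ∀ b : ZMod 2, ∃ s ∈ A, ∃ u, C.nextState s u ∈ B ∧ C.codeBit s u l = b ∧
    ∀ l', l' ≠ l → e l' = false → C.codeBit s u l' = 0

open Classical in
/-- The conditional probability that code bit `l` remains undetermined, given the metrics. -/
def outputErasure (C : RSCEncoder) (l : Fin 2) (p : Fin 2 → ℝ) :
    Matrix (Finset C.State) (Finset C.State) ℝ :=
  fun A B => ∑ e, if C.Undetermined l A B e then erasureWeight p e else 0

/-- The transfer function of the BCJR decoder for code bit `l`: the extrinsic erasure probability
of that bit in the steady state, where `p` collects the input erasure probabilities. -/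
def transfer (C : RSCEncoder) (l : Fin 2) (p : Fin 2 → ℝ) : ℝ :=
  C.forwardLaw p ⬝ᵥ (C.outputErasure l p *ᵥ C.backwardLaw p)

/-- The transfer function for the systematic bit, as a function of the input erasure probabilities
of the systematic bit and of the parity bit. -/
def sysTransfer (C : RSCEncoder) (p₁ p₂ : ℝ) : ℝ := C.transfer 0 ![p₁, p₂]

end RSCEncoder

/-! ### Vector admissible systems -/

/-- The cube `[0, 1]ᵈ`. -/
def unitCube (d : ℕ) : Set (Fin d → ℝ) := Icc 0 1

/-- The linear form `v ↦ ∑ i, a i * v i`. -/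
def rowForm {d : ℕ} (a : Fin d → ℝ) : (Fin d → ℝ) →L[ℝ] ℝ :=
  ∑ i, a i • ContinuousLinearMap.proj (R := ℝ) (φ := fun _ : Fin d => ℝ) i

/-- The recursion `x ↦ f (g x) ε` with parameter `ε ∈ E` is a vector admissible system, with the
positive diagonal matrix `D` and the functionals `F`, `G` satisfying `F' = f D`, `G' = g D`. -/
structure IsVectorAdmissible {d : ℕ} (E : Set ℝ)
    (f : (Fin d → ℝ) → ℝ → (Fin d → ℝ)) (g : (Fin d → ℝ) → (Fin d → ℝ))
    (D : Matrix (Fin d) (Fin d) ℝ) (F : (Fin d → ℝ) → ℝ → ℝ) (G : (Fin d → ℝ) → ℝ) : Prop where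
  diag : D.IsDiag
  diag_pos : ∀ i, 0 < D i i
  f_mapsTo : ∀ x ∈ unitCube d, ∀ ε ∈ E, f x ε ∈ unitCube d
  g_mapsTo : ∀ x ∈ unitCube d, g x ∈ unitCube d
  f_contDiff : ContDiffOn ℝ 2 (fun z : (Fin d → ℝ) × ℝ => f z.1 z.2) (unitCube d ×ˢ E)
  g_contDiff : ContDiffOn ℝ 2 g (unitCube d)
  f_mono : ∀ x ∈ unitCube d, ∀ y ∈ unitCube d, ∀ ε ∈ E, ∀ ε' ∈ E,
    x ≤ y → ε ≤ ε' → f x ε ≤ f y ε'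
  g_mono : ∀ x ∈ unitCube d, ∀ y ∈ unitCube d, x ≤ y → g x ≤ g y
  F_deriv : ∀ ε ∈ E, ∀ x ∈ unitCube d,
    HasFDerivWithinAt (fun y => F y ε) (rowForm (f x ε ᵥ* D)) (unitCube d) x
  G_deriv : ∀ x ∈ unitCube d, HasFDerivWithinAt G (rowForm (g x ᵥ* D)) (unitCube d) x
  f_zero : ∀ ε ∈ E, f (g 0) ε = 0
  F_zero : ∀ ε ∈ E, F (g 0) ε = 0
  G_zero : G 0 = 0

/-- The potential function `U(x; ε) = g(x) D xᵀ - G(x) - F(g(x); ε)`. -/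
def potential {d : ℕ} (g : (Fin d → ℝ) → (Fin d → ℝ)) (D : Matrix (Fin d) (Fin d) ℝ)
    (F : (Fin d → ℝ) → ℝ → ℝ) (G : (Fin d → ℝ) → ℝ) (x : Fin d → ℝ) (ε : ℝ) : ℝ :=
  (g x ᵥ* D) ⬝ᵥ x - G x - F (g x) ε

/-- The integrand of the line integral `∫ (z - f(g(z); ε)) D g'(z) · dz` along the path `γ`. -/
def potentialIntegrand {d : ℕ} (f : (Fin d → ℝ) → ℝ → (Fin d → ℝ))
    (g : (Fin d → ℝ) → (Fin d → ℝ)) (D : Matrix (Fin d) (Fin d) ℝ) (ε : ℝ)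
    (γ : ℝ → (Fin d → ℝ)) (t : ℝ) : ℝ :=
  ((γ t - f (g (γ t)) ε) ᵥ* D) ⬝ᵥ
    (fderivWithin ℝ g (unitCube d) (γ t) (derivWithin γ (Icc 0 1) t))

/-- The nonzero fixed points of the recursion `x ↦ f (g x) ε` in the cube. -/
def nonzeroFixedPoints {d : ℕ} (f : (Fin d → ℝ) → ℝ → (Fin d → ℝ))
    (g : (Fin d → ℝ) → (Fin d → ℝ)) (ε : ℝ) : Set (Fin d → ℝ) :=
  {x | x ∈ unitCube d ∧ x ≠ 0 ∧ f (g x) ε = x}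

/-- The energy gap: the infimum of the potential over the nonzero fixed points
(`⊤` if there are none). -/
def energyGap {d : ℕ} (f : (Fin d → ℝ) → ℝ → (Fin d → ℝ)) (g : (Fin d → ℝ) → (Fin d → ℝ))
    (D : Matrix (Fin d) (Fin d) ℝ) (F : (Fin d → ℝ) → ℝ → ℝ) (G : (Fin d → ℝ) → ℝ)
    (ε : ℝ) : EReal :=
  ⨅ x ∈ nonzeroFixedPoints f g ε, (potential g D F G x ε : EReal)

/-- The potential threshold: the supremum of the parameters with positive energy gap. -/
def potentialThreshold {d : ℕ} (E : Set ℝ) (f : (Fin d → ℝ) → ℝ → (Fin d → ℝ))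
    (g : (Fin d → ℝ) → (Fin d → ℝ)) (D : Matrix (Fin d) (Fin d) ℝ)
    (F : (Fin d → ℝ) → ℝ → ℝ) (G : (Fin d → ℝ) → ℝ) : ℝ :=
  sSup {ε | ε ∈ E ∧ 0 < energyGap f g D F G ε}

/-- One step of the spatially coupled recursion with coupling memory `m` and coupling length `L`,
where `f t` is the map at position `t`; positions outside `1, …, L` are held at `0`:
`x_t ↦ 1/(m+1) ∑_j f_{t+j} (1/(m+1) ∑_k g (x_{t+j-k}))`. -/
def coupledStep {d : ℕ} (m L : ℕ) (f : ℤ → (Fin d → ℝ) → (Fin d → ℝ))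
    (g : (Fin d → ℝ) → (Fin d → ℝ)) (x : ℤ → (Fin d → ℝ)) : ℤ → (Fin d → ℝ) := fun t =>
  if 1 ≤ t ∧ t ≤ L then
    (1 / ((m : ℝ) + 1)) • ∑ j ∈ Finset.range (m + 1),
      f (t + j) ((1 / ((m : ℝ) + 1)) • ∑ k ∈ Finset.range (m + 1), g (x (t + j - k)))
  else 0

/-! ### Density evolution of parallel concatenated codes -/

/-- The erasure probability `ε_ρ = 1 - (1 - ε) ρ` of a bit sequence that is randomly punctured with
permeability rate `ρ` and sent over the erasure channel with erasure probability `ε`. -/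
def puncturedErasure (ρ ε : ℝ) : ℝ := 1 - (1 - ε) * ρ

/-- The vector map with component functions `fU(e₀ x₁, e₁)` and `fL(e₀ x₂, e₂)`. -/
def pccMap (fU fL : ℝ → ℝ → ℝ) (e₀ e₁ e₂ : ℝ) (x : Fin 2 → ℝ) : Fin 2 → ℝ :=
  ![fU (e₀ * x 0) e₁, fL (e₀ * x 1) e₂]

/-- The map `f(x; ε)` of a randomly punctured parallel concatenated code. -/
def pccF (CU CL : RSCEncoder) (ρ₀ ρ₁ ρ₂ : ℝ) (x : Fin 2 → ℝ) (ε : ℝ) : Fin 2 → ℝ :=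
  pccMap CU.sysTransfer CL.sysTransfer
    (puncturedErasure ρ₀ ε) (puncturedErasure ρ₁ ε) (puncturedErasure ρ₂ ε) x

/-- The map `g(x) = (x₂, x₁)`. -/
def pccG (x : Fin 2 → ℝ) : Fin 2 → ℝ := ![x 1, x 0]

/-- The functional `F(x; ε)`. -/
def pccFInt (CU CL : RSCEncoder) (ρ₀ ρ₁ ρ₂ : ℝ) (x : Fin 2 → ℝ) (ε : ℝ) : ℝ :=
  (∫ z in (0 : ℝ)..x 0, CU.sysTransfer (puncturedErasure ρ₀ ε * z) (puncturedErasure ρ₁ ε))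
    + ∫ z in (0 : ℝ)..x 1, CL.sysTransfer (puncturedErasure ρ₀ ε * z) (puncturedErasure ρ₂ ε)

/-- The functional `G(x) = x₁ x₂`. -/
def pccGInt (x : Fin 2 → ℝ) : ℝ := x 0 * x 1

/-- One density evolution iteration of the uncoupled punctured ensemble. The vector `p` collects
the extrinsic erasure probabilities of the information bits at the output of the upper (`p 0`)
and of the lower (`p 1`) decoder. -/
def pccDE (CU CL : RSCEncoder) (ρ₀ ρ₁ ρ₂ ε : ℝ) (p : Fin 2 → ℝ) : Fin 2 → ℝ :=
  let qL := puncturedErasure ρ₀ ε * p 1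
  let qU := puncturedErasure ρ₀ ε * p 0
  ![CU.sysTransfer qL (puncturedErasure ρ₁ ε), CL.sysTransfer qU (puncturedErasure ρ₂ ε)]

/-- The average erasure probability that the information sequence at time `t` receives from the
upper (component `0`) and from the lower (component `1`) trellises at times `t, …, t + m`. The
information sequences at times outside `1, …, L` are known, which amounts to the value `0`. -/
def scAverage (m L : ℕ) (p : ℤ → (Fin 2 → ℝ)) (t : ℤ) : Fin 2 → ℝ := fun c =>
  if 1 ≤ t ∧ t ≤ L then (1 / ((m : ℝ) + 1)) * ∑ j ∈ Finset.range (m + 1), p (t + j) c else 0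

/-- The input erasure probability of the parity sequences at time `t`: it is that of the channel for
`1 ≤ t ≤ L`, and `0` for the known sequences at all other times. -/
def scParityErasure (L : ℕ) (e : ℝ) (t : ℤ) : ℝ := if 1 ≤ t ∧ t ≤ L then e else 0

/-- The erasure probability from the information sequences at times `t - m, …, t` to the trellis at
time `t`, computed from the averages of the lower (`c = 1`) or upper (`c = 0`) decoders. -/
def scInput (m L : ℕ) (e₀ : ℝ) (p : ℤ → (Fin 2 → ℝ)) (t : ℤ) (c : Fin 2) : ℝ :=
  e₀ * ((1 / ((m : ℝ) + 1)) * ∑ k ∈ Finset.range (m + 1), scAverage m L p (t - k) c)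

/-- One density evolution iteration of the punctured SC-PCC ensemble with coupling memory `m` and
coupling length `L`. Here `p t` collects the extrinsic erasure probabilities of the information bits
at the output of the upper (`p t 0`) and of the lower (`p t 1`) decoder at time `t`. -/
def scPccDE (CU CL : RSCEncoder) (ρ₀ ρ₁ ρ₂ : ℝ) (m L : ℕ) (ε : ℝ) (p : ℤ → (Fin 2 → ℝ)) :
    ℤ → (Fin 2 → ℝ) := fun t =>
  let qL := scInput m L (puncturedErasure ρ₀ ε) p t 1
  let qU := scInput m L (puncturedErasure ρ₀ ε) p t 0
  ![CU.sysTransfer qL (scParityErasure L (puncturedErasure ρ₁ ε) t),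
    CL.sysTransfer qU (scParityErasure L (puncturedErasure ρ₂ ε) t)]

/-- The a-posteriori erasure probability of the information sequence at time `t`. -/
def scAPosteriori (ρ₀ : ℝ) (m L : ℕ) (ε : ℝ) (p : ℤ → (Fin 2 → ℝ)) (t : ℤ) : ℝ :=
  puncturedErasure ρ₀ ε * scAverage m L p t 0 * scAverage m L p t 1

/-- The map at position `t` of the coupled vector recursion of the SC-PCC ensemble: it is `f(·; ε)`
for `1 ≤ t ≤ L`, and at all other times the parity bits are known. -/
def scPccMap (CU CL : RSCEncoder) (ρ₀ ρ₁ ρ₂ : ℝ) (L : ℕ) (ε : ℝ) (t : ℤ) (x : Fin 2 → ℝ) :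
    Fin 2 → ℝ :=
  if 1 ≤ t ∧ t ≤ L then pccF CU CL ρ₀ ρ₁ ρ₂ x ε
  else pccMap CU.sysTransfer CL.sysTransfer (puncturedErasure ρ₀ ε) 0 0 x

end

/-! The transfer function is a bilinear form in the two steady-state laws, with coefficients
polynomial in the erasure probabilities, so its regularity is that of the laws. If some erasure
pattern of positive probability, repeated often enough, sends every metric vector containing the
zero state to one and the same vector, then splitting off this common part (Doeblin) turns
stationarity into a linear system with strictly diagonally dominant columns, and Cramer's rule gives
smoothness (`contDiffWithinAt_steadyState`). Two patterns reset in this way. Without erasures only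
the zero state survives, because the coprimality of `num` and `den` makes the trellis observable
(`eq_zero_of_idleParity`). With both bits erased every state becomes possible, because the register
can be loaded freely. Only the corners (1, 0) and (0, 1) of the square escape both patterns.
Positive parity permeability and ε < 1 exclude the second corner; excluding ε = 0 when ρ₀ = 0
excludes the first.

Monotonicity holds because both metric recursions and the event of remaining undetermined grow with
the metrics and with the erasure pattern. The transfer function vanishes for known systematic bits
because the encoder is recursive: the response to a single input 1 never returns to the zero state
(`idleState_iterate_ne_zero`). The line integral is path independent because each component of `f`
depends on one variable only, so the form is d(x₁x₂) minus two forms in one variable each.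

For threshold saturation, pick ε' > ε with positive energy gap. The coupled recursion at ε is
dominated by a recursion at ε' on the half-line t ≥ 1 without right boundary. Started from 1, the
latter decreases to a fixed point (a, b) that is nondecreasing in t, and whose limit (α, β) at
infinity is a fixed point of the uncoupled recursion. Telescoping a b and summing by parts, since
the two window averages are adjoint to each other, yields two Riemann sums of monotone functions
with mesh at most 1/(m+1). Hence the potential at (α, β) is at most 2/(m+1) (`potential_ciSup_le`).
For large m this is below the energy gap, so (α, β) = 0, and the monotone profiles vanish
identically. -/

theorem mem_unitCube {d : ℕ} {x : Fin d → ℝ} : x ∈ unitCube d ↔ ∀ i, x i ∈ Icc (0 : ℝ) 1 := by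
  simp only [unitCube, Set.mem_Icc, Pi.le_def, Pi.zero_apply, Pi.one_apply]
  exact forall_and.symm

/-! ### Chains of metric vectors -/

theorem sum_erasureWeight_mul (p : Fin 2 → ℝ) (φ : (Fin 2 → Bool) → ℝ) :
    ∑ e, erasureWeight p e * φ e =
      (1 - p 0) * (1 - p 1) * φ ![false, false] + (1 - p 0) * p 1 * φ ![false, true]
        + p 0 * (1 - p 1) * φ ![true, false] + p 0 * p 1 * φ ![true, true] := by
  have huniv : (Finset.univ : Finset (Fin 2 → Bool)) =
      {![false, false], ![false, true], ![true, false], ![true, true]} := by decide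
  rw [huniv, Finset.sum_insert (by decide), Finset.sum_insert (by decide),
    Finset.sum_insert (by decide), Finset.sum_singleton]
  simp [erasureWeight]
  ring

/-- The expectation of a monotone function of the erasure pattern is monotone in the erasure
probabilities. -/
theorem sum_erasureWeight_mul_mono {p p' : Fin 2 → ℝ} (hp : p ∈ unitCube 2) (hp' : p' ∈ unitCube 2)
    (h : p ≤ p') {φ : (Fin 2 → Bool) → ℝ} (hφ : Monotone φ) :
    ∑ e, erasureWeight p e * φ e ≤ ∑ e, erasureWeight p' e * φ e := by
  rw [mem_unitCube] at hp hp'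
  rw [sum_erasureWeight_mul, sum_erasureWeight_mul]
  have h₁ : φ ![false, false] ≤ φ ![false, true] := hφ (fun i => by fin_cases i <;> decide)
  have h₂ : φ ![false, false] ≤ φ ![true, false] := hφ (fun i => by fin_cases i <;> decide)
  have h₃ : φ ![false, true] ≤ φ ![true, true] := hφ (fun i => by fin_cases i <;> decide)
  have h₄ : φ ![true, false] ≤ φ ![true, true] := hφ (fun i => by fin_cases i <;> decide)
  -- The probabilities are raised one at a time: `e₁` is the gain from moving `p 0` with `p 1`
  -- fixed, `e₂` the gain from then moving `p 1` with `p' 0` fixed.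
  have e₁ : 0 ≤ (p' 0 - p 0) * ((1 - p 1) * (φ ![true, false] - φ ![false, false])
      + p 1 * (φ ![true, true] - φ ![false, true])) :=
    mul_nonneg (sub_nonneg.2 (h 0)) (add_nonneg
      (mul_nonneg (sub_nonneg.2 (hp 1).2) (sub_nonneg.2 h₂))
      (mul_nonneg (hp 1).1 (sub_nonneg.2 h₃)))
  have e₂ : 0 ≤ (p' 1 - p 1) * ((1 - p' 0) * (φ ![false, true] - φ ![false, false])
      + p' 0 * (φ ![true, true] - φ ![true, false])) :=
    mul_nonneg (sub_nonneg.2 (h 1)) (add_nonneg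
      (mul_nonneg (sub_nonneg.2 (hp' 0).2) (sub_nonneg.2 h₁))
      (mul_nonneg (hp' 0).1 (sub_nonneg.2 h₄)))
  linarith

theorem contDiff_erasureWeight {n : WithTop ℕ∞} (e : Fin 2 → Bool) :
    ContDiff ℝ n fun p : Fin 2 → ℝ => erasureWeight p e := by
  unfold erasureWeight
  refine contDiff_prod fun l _ => ?_
  split_ifs
  · exact contDiff_apply ℝ ℝ l
  · exact contDiff_const.sub (contDiff_apply ℝ ℝ l)

section Chain

variable {S : Type} [Fintype S] {step : (Fin 2 → Bool) → Finset S → Finset S} {z : S}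
  {p : Fin 2 → ℝ}

theorem metricTransition_nonneg (hp : p ∈ unitCube 2) (B A : Finset S) :
    0 ≤ metricTransition step p B A := by
  unfold metricTransition
  refine Finset.sum_nonneg fun e _ => ?_
  split_ifs
  · exact erasureWeight_nonneg (mem_unitCube.1 hp) e
  · exact le_rfl

open Classical in
theorem metricLaw_zero : metricLaw step z p 0 = Pi.single {z} 1 := by
  simp only [metricLaw, pow_zero, Matrix.one_mulVec]

theorem metricLaw_succ (n : ℕ) :
    metricLaw step z p (n + 1) = metricTransition step p *ᵥ metricLaw step z p n := by
  classical
  simp only [metricLaw]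
  rw [Matrix.mulVec_mulVec, pow_succ']

theorem metricLaw_nonneg (hp : p ∈ unitCube 2) (n : ℕ) (A : Finset S) :
    0 ≤ metricLaw step z p n A := by
  classical
  induction n generalizing A with
  | zero =>
    rw [metricLaw_zero]
    by_cases h : A = {z}
    · subst h; simp
    · simp [h]
  | succ n ih =>
    rw [metricLaw_succ]
    exact Finset.sum_nonneg fun B _ => mul_nonneg (metricTransition_nonneg hp _ _) (ih B)

open Classical in
theorem dotProduct_metricLaw (h : Finset S → ℝ) (n : ℕ) :
    h ⬝ᵥ metricLaw step z p n = (h ᵥ* metricTransition step p ^ n) {z} := by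
  simp only [metricLaw]
  rw [Matrix.dotProduct_mulVec]
  simp

open Classical in
theorem vecMul_metricTransition_pow_succ (h : Finset S → ℝ) (n : ℕ) (A : Finset S) :
    (h ᵥ* metricTransition step p ^ (n + 1)) A =
      ∑ e, erasureWeight p e * (h ᵥ* metricTransition step p ^ n) (step e A) := by
  rw [pow_succ, ← Matrix.vecMul_vecMul, vecMul_metricTransition]

open Classical in
theorem one_vecMul_metricTransition_pow (n : ℕ) :
    (1 : Finset S → ℝ) ᵥ* metricTransition step p ^ n = 1 := by
  induction n with
  | zero => simp
  | succ n ih =>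
    funext A
    rw [vecMul_metricTransition_pow_succ, ih]
    simpa using sum_erasureWeight p

theorem sum_metricLaw (n : ℕ) : ∑ A, metricLaw step z p n A = 1 := by
  classical
  have h := dotProduct_metricLaw (step := step) (z := z) (p := p) 1 n
  rw [one_vecMul_metricTransition_pow] at h
  simpa [dotProduct] using h

/-- A property of metric vectors that all transitions of positive probability preserve holds on the
support of the law. -/
theorem metricLaw_eq_zero_of_not {P : Finset S → Prop} (hz : P {z})
    (hP : ∀ e, erasureWeight p e ≠ 0 → ∀ A, P A → P (step e A)) (n : ℕ) {A : Finset S}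
    (hA : ¬ P A) : metricLaw step z p n A = 0 := by
  classical
  induction n generalizing A with
  | zero =>
    have : A ≠ {z} := fun h => hA (h ▸ hz)
    rw [metricLaw_zero]
    simp [this]
  | succ n ih =>
    rw [metricLaw_succ]
    refine Finset.sum_eq_zero fun B _ => ?_
    by_cases hB : P B
    · refine mul_eq_zero_of_left (Finset.sum_eq_zero fun e _ => ?_) _
      split_ifs with h
      · by_contra h0
        exact hA (h ▸ hP e h0 B hB)
      · rfl
    · exact mul_eq_zero_of_right _ (ih hB)

theorem steadyState_eq_zero_of_not {P : Finset S → Prop} (hz : P {z})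
    (hP : ∀ e, erasureWeight p e ≠ 0 → ∀ A, P A → P (step e A)) {A : Finset S}
    (hA : ¬ P A) : steadyState step z p A = 0 := by
  simp only [steadyState, metricLaw_eq_zero_of_not hz hP _ hA]
  exact tendsto_const_nhds.limUnder_eq

/-- The known state survives every step by monotonicity. Consequently a reset needs to be checked
only on metric vectors that contain it. -/
theorem steadyState_eq_zero_of_notMem (hmono : ∀ e, Monotone (step e)) (hz : ∀ e, z ∈ step e {z})
    {A : Finset S} (hA : z ∉ A) : steadyState step z p A = 0 :=
  steadyState_eq_zero_of_not (P := fun A => z ∈ A) (Finset.mem_singleton_self z)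
    (fun e _ _ hB => hmono e (Finset.singleton_subset_iff.2 hB) (hz e)) hA

theorem tendsto_dotProduct_metricLaw (hmono : ∀ e, Monotone (step e)) (hz : ∀ e, z ∈ step e {z})
    (hp : p ∈ unitCube 2) (h : Finset S → ℝ) :
    Tendsto (fun n => h ⬝ᵥ metricLaw step z p n) atTop (𝓝 (h ⬝ᵥ steadyState step z p)) := by
  have h₁ := tendsto_metricLaw hmono hz (mem_unitCube.1 hp)
  exact tendsto_finsetSum _ fun A _ => (tendsto_pi_nhds.1 h₁ A).const_mul _

theorem steadyState_nonneg (hmono : ∀ e, Monotone (step e)) (hz : ∀ e, z ∈ step e {z})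
    (hp : p ∈ unitCube 2) (A : Finset S) : 0 ≤ steadyState step z p A :=
  ge_of_tendsto' (tendsto_pi_nhds.1 (tendsto_metricLaw hmono hz (mem_unitCube.1 hp)) A)
    fun n => metricLaw_nonneg hp n A

theorem sum_steadyState (hmono : ∀ e, Monotone (step e)) (hz : ∀ e, z ∈ step e {z})
    (hp : p ∈ unitCube 2) : ∑ A, steadyState step z p A = 1 := by
  have h := tendsto_dotProduct_metricLaw hmono hz hp 1
  simp only [dotProduct, Pi.one_apply, one_mul, sum_metricLaw] at h
  exact tendsto_nhds_unique h tendsto_const_nhds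

/-- The steady-state expectation of a monotone function of the metric vector is monotone in the
erasure probabilities. -/
theorem dotProduct_steadyState_mono (hmono : ∀ e, Monotone (step e)) (hz : ∀ e, z ∈ step e {z})
    {p' : Fin 2 → ℝ} (hp : p ∈ unitCube 2) (hp' : p' ∈ unitCube 2)
    (hpp' : p ≤ p') (hstep : Monotone step) {h : Finset S → ℝ} (hh : Monotone h) :
    h ⬝ᵥ steadyState step z p ≤ h ⬝ᵥ steadyState step z p' := by
  classical
  -- Coupling in backward form: the law of the first step is changed while the remaining
  -- expectation, monotone in the metric, is kept; then the remaining steps are changed by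
  -- induction.
  have key : ∀ n, Monotone (h ᵥ* metricTransition step p ^ n) ∧
      ∀ A, (h ᵥ* metricTransition step p ^ n) A ≤ (h ᵥ* metricTransition step p' ^ n) A := by
    intro n
    induction n with
    | zero => simpa using hh
    | succ n ih =>
      refine ⟨fun A B hAB => ?_, fun A => ?_⟩
      · rw [vecMul_metricTransition_pow_succ, vecMul_metricTransition_pow_succ]
        exact Finset.sum_le_sum fun e _ => mul_le_mul_of_nonneg_left (ih.1 (hmono e hAB))
          (erasureWeight_nonneg (mem_unitCube.1 hp) e)
      · rw [vecMul_metricTransition_pow_succ, vecMul_metricTransition_pow_succ]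
        calc _ ≤ ∑ e, erasureWeight p' e * (h ᵥ* metricTransition step p ^ n) (step e A) :=
              sum_erasureWeight_mul_mono hp hp' hpp' fun e e' he => ih.1 (hstep he A)
          _ ≤ _ := Finset.sum_le_sum fun e _ => mul_le_mul_of_nonneg_left (ih.2 _)
              (erasureWeight_nonneg (mem_unitCube.1 hp') e)
  refine le_of_tendsto_of_tendsto' (tendsto_dotProduct_metricLaw hmono hz hp h)
    (tendsto_dotProduct_metricLaw hmono hz hp' h) fun n => ?_
  rw [dotProduct_metricLaw, dotProduct_metricLaw]
  exact (key n).2 _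

end Chain

/-! ### Smoothness of the steady state -/

theorem contDiffWithinAt_det {ι E : Type*} [Fintype ι] [DecidableEq ι] [NormedAddCommGroup E]
    [NormedSpace ℝ E] {n : WithTop ℕ∞} {M : E → Matrix ι ι ℝ} {s : Set E} {x : E}
    (hM : ∀ i j, ContDiffWithinAt ℝ n (fun y => M y i j) s x) :
    ContDiffWithinAt ℝ n (fun y => (M y).det) s x := by
  simp only [Matrix.det_apply']
  exact ContDiffWithinAt.sum fun σ _ =>
    contDiffWithinAt_const.mul (contDiffWithinAt_prod fun i _ => hM _ _)

/-- The solution of a regular system of linear equations is a smooth function of its entries. -/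
theorem contDiffWithinAt_of_mulVec_eq {ι E : Type*} [Fintype ι] [DecidableEq ι]
    [NormedAddCommGroup E] [NormedSpace ℝ E] {n : WithTop ℕ∞} {M : E → Matrix ι ι ℝ}
    {b v : E → ι → ℝ} {s : Set E} {x : E} (hx : x ∈ s)
    (hM : ∀ i j, ContDiffWithinAt ℝ n (fun y => M y i j) s x)
    (hb : ∀ i, ContDiffWithinAt ℝ n (fun y => b y i) s x)
    (h : ∀ᶠ y in 𝓝[s] x, (M y).det ≠ 0 ∧ M y *ᵥ v y = b y) (i : ι) :
    ContDiffWithinAt ℝ n (fun y => v y i) s x := by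
  have hx' := mem_of_mem_nhdsWithin hx h
  -- Cramer's rule: a component of the solution is a quotient of determinants.
  have hc : ContDiffWithinAt ℝ n (fun y => ((M y).updateCol i (b y)).det / (M y).det) s x := by
    refine ContDiffWithinAt.div (contDiffWithinAt_det fun j k => ?_) (contDiffWithinAt_det hM) hx'.1
    by_cases hk : k = i
    · subst hk
      simpa using hb j
    · simpa [hk] using hM j k
  have heq : ∀ y, (M y).det ≠ 0 ∧ M y *ᵥ v y = b y →
      v y i = ((M y).updateCol i (b y)).det / (M y).det := by
    rintro y ⟨h0, h1⟩
    rw [eq_div_iff h0, ← Matrix.cramer_apply, ← h1, Matrix.cramer_eq_adjugate_mulVec,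
      Matrix.mulVec_mulVec, Matrix.adjugate_mul, Matrix.smul_mulVec, Matrix.one_mulVec]
    simp [mul_comm]
  exact hc.congr_of_eventuallyEq (h.mono heq) (heq x hx')

section Smooth

variable {S : Type} [Fintype S] {step : (Fin 2 → Bool) → Finset S → Finset S} {z : S}
  {p : Fin 2 → ℝ}

open Classical in
theorem contDiff_metricTransition_pow {k : WithTop ℕ∞} (n : ℕ) (B A : Finset S) :
    ContDiff ℝ k fun p : Fin 2 → ℝ => (metricTransition step p ^ n) B A := by
  induction n generalizing B A with
  | zero => simpa using contDiff_const
  | succ n ih =>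
    simp only [pow_succ, Matrix.mul_apply]
    refine ContDiff.sum fun C _ => (ih B C).mul (ContDiff.sum fun e _ => ?_)
    split_ifs
    · exact contDiff_erasureWeight e
    · exact contDiff_const

-- One way to move from `A` to its `n`-th image under `step e` is to see the pattern `e` at each of
-- the `n` steps. This is the minorization that is split off in Doeblin's argument.
open Classical in
theorem le_metricTransition_pow (hp : p ∈ unitCube 2) (e : Fin 2 → Bool) (n : ℕ)
    (B A : Finset S) :
    (if B = (step e)^[n] A then erasureWeight p e ^ n else 0)
      ≤ (metricTransition step p ^ n) B A := by
  have hnn : ∀ (n : ℕ) (B A : Finset S), 0 ≤ (metricTransition step p ^ n) B A := by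
    intro n
    induction n with
    | zero =>
      intro B A
      rw [pow_zero, Matrix.one_apply]
      split_ifs <;> norm_num
    | succ n ih =>
      intro B A
      rw [pow_succ, Matrix.mul_apply]
      exact Finset.sum_nonneg fun C _ => mul_nonneg (ih _ _) (metricTransition_nonneg hp _ _)
  induction n generalizing A with
  | zero => simp [Matrix.one_apply]
  | succ n ih =>
    split_ifs with h
    · rw [pow_succ, pow_succ, Matrix.mul_apply]
      refine le_trans ?_ (Finset.single_le_sum (fun C _ => mul_nonneg (hnn n B C)
        (metricTransition_nonneg hp C A)) (Finset.mem_univ (step e A)))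
      have h₁ := ih (step e A)
      rw [if_pos (by simpa using h)] at h₁
      refine mul_le_mul h₁ ?_ (erasureWeight_nonneg (mem_unitCube.1 hp) e) (hnn _ _ _)
      unfold metricTransition
      refine le_trans (by simp) (Finset.single_le_sum (fun e' _ => ?_) (Finset.mem_univ e))
      split_ifs
      · exact erasureWeight_nonneg (mem_unitCube.1 hp) e'
      · exact le_rfl
    · exact hnn _ _ _

/-- If sufficiently many repetitions of an erasure pattern `e` of positive probability turn every
metric vector into the same one, then the steady state is a smooth function of the erasure
probabilities. -/
theorem contDiffWithinAt_steadyState {k : WithTop ℕ∞} (hmono : ∀ e, Monotone (step e))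
    (hz : ∀ e, z ∈ step e {z}) (hp : p ∈ unitCube 2) {e : Fin 2 → Bool}
    (he : 0 < erasureWeight p e) {n : ℕ} {A₀ : Finset S}
    (hA₀ : ∀ A, z ∈ A → (step e)^[n] A = A₀) (A : Finset S) :
    ContDiffWithinAt ℝ k (fun q => steadyState step z q A) (unitCube 2) p := by
  classical
  -- `R` is the `n`-step transition matrix with the common mass at `A₀` removed. Columns of vectors
  -- without `z` carry no steady-state mass and are set to zero, since no reset is assumed there. As
  -- the steady state sums to 1, it solves `(1 - R) v = b` with `b` the removed mass at `A₀`.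
  let R : (Fin 2 → ℝ) → Matrix (Finset S) (Finset S) ℝ := fun q B A =>
    if z ∈ A then (metricTransition step q ^ n) B A
      - (if B = A₀ then erasureWeight q e ^ n else 0) else 0
  have hdelta : ∀ B, ContDiff ℝ k
      fun q : Fin 2 → ℝ => if B = A₀ then erasureWeight q e ^ n else 0 := by
    intro B
    split_ifs
    · exact (contDiff_erasureWeight e).pow n
    · exact contDiff_const
  refine contDiffWithinAt_of_mulVec_eq (M := fun q => 1 - R q)
    (b := fun q B => if B = A₀ then erasureWeight q e ^ n else 0)
    (v := fun q => steadyState step z q) hp (fun B C => ?_)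
    (fun B => (hdelta B).contDiffWithinAt) ?_ A
  · refine ContDiff.contDiffWithinAt ?_
    change ContDiff ℝ k fun q : Fin 2 → ℝ => (1 : Matrix (Finset S) (Finset S) ℝ) B C -
      if z ∈ C then (metricTransition step q ^ n) B C
        - (if B = A₀ then erasureWeight q e ^ n else 0) else 0
    refine contDiff_const.sub ?_
    split_ifs
    · exact (contDiff_metricTransition_pow n B C).sub ((contDiff_erasureWeight e).pow n)
    · exact (contDiff_metricTransition_pow n B C).sub contDiff_const
    · exact contDiff_const
  have hcont : ContinuousWithinAt (fun q => erasureWeight q e) (unitCube 2) p :=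
    (contDiff_erasureWeight (n := 0) e).continuous.continuousWithinAt
  filter_upwards [hcont.eventually (lt_mem_nhds he), self_mem_nhdsWithin] with q hq hqc
  have hR0 : ∀ B C, 0 ≤ R q B C := by
    intro B C
    simp only [R]
    by_cases h : z ∈ C
    · rw [if_pos h]
      have := le_metricTransition_pow (step := step) hqc e n B C
      rw [hA₀ C h] at this
      linarith
    · rw [if_neg h]
  have hcol : ∀ C, ∑ B, (metricTransition step q ^ n) B C = 1 := by
    intro C
    have := congrFun (one_vecMul_metricTransition_pow (step := step) (p := q) n) C
    simpa [Matrix.vecMul, dotProduct] using this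
  have hRcol : ∀ C, ∑ B, R q B C < 1 := by
    intro C
    simp only [R]
    by_cases h : z ∈ C
    · simp only [if_pos h, Finset.sum_sub_distrib, hcol, Finset.sum_ite_eq', Finset.mem_univ]
      have := pow_pos hq n
      simpa using this
    · simp [h]
  -- A nonnegative `R` with column sums below 1 makes `1 - R` strictly diagonally dominant by
  -- columns.
  refine ⟨det_ne_zero_of_sum_col_lt_diag fun C => ?_, ?_⟩
  · have h₁ : ∑ B ∈ Finset.univ.erase C, ‖(1 - R q) B C‖
        = ∑ B ∈ Finset.univ.erase C, R q B C := by
      refine Finset.sum_congr rfl fun B hB => ?_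
      rw [Matrix.sub_apply, Matrix.one_apply_ne (Finset.ne_of_mem_erase hB), zero_sub, norm_neg,
        Real.norm_of_nonneg (hR0 B C)]
    have h₂ := Finset.add_sum_erase Finset.univ (fun B => R q B C) (Finset.mem_univ C)
    rw [h₁, Matrix.sub_apply, Matrix.one_apply_eq]
    refine lt_of_lt_of_le ?_ (Real.le_norm_self _)
    have := hRcol C
    beta_reduce at h₂
    linarith
  · have hst : ∀ n : ℕ, (metricTransition step q ^ n) *ᵥ steadyState step z q
        = steadyState step z q := by
      intro n
      induction n with
      | zero => simp
      | succ n ih =>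
        rw [pow_succ, ← Matrix.mulVec_mulVec,
          metricTransition_mulVec_steadyState hmono hz (mem_unitCube.1 hqc), ih]
    funext B
    rw [Matrix.sub_mulVec, Matrix.one_mulVec, Pi.sub_apply]
    have hterm : ∀ C, R q B C * steadyState step z q C
        = (metricTransition step q ^ n) B C * steadyState step z q C
          - (if B = A₀ then erasureWeight q e ^ n else 0) * steadyState step z q C := by
      intro C
      simp only [R]
      by_cases h : z ∈ C
      · rw [if_pos h, sub_mul]
      · rw [steadyState_eq_zero_of_notMem hmono hz h]
        simp
    have : (R q *ᵥ steadyState step z q) B = steadyState step z q B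
        - (if B = A₀ then erasureWeight q e ^ n else 0) := by
      simp only [Matrix.mulVec, dotProduct]
      rw [Finset.sum_congr rfl fun C _ => hterm C, Finset.sum_sub_distrib, ← Finset.mul_sum,
        sum_steadyState hmono hz hqc, mul_one]
      congr 1
      exact congrFun (hst n) B
    rw [this]
    ring

end Smooth

/-! ### The trellis under zero input -/

/-- A sequence with a linear recurrence that vanishes eventually vanishes from the start on, up to
the part of the sequence that the recurrence does not reach. -/
theorem eq_zero_of_recurrence {R : ℕ → ZMod 2} {c : ℕ → ZMod 2} {ν d N : ℕ} (hd : d ≤ ν)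
    (hc : c d = 1) (hc' : ∀ i, d < i → c i = 0)
    (h : ∀ n, ∑ i ∈ Finset.range (ν + 1), c i * R (n + ν - i) = 0)
    (hN : ∀ k, N ≤ k → R k = 0) {k : ℕ} (hk : ν - d ≤ k) : R k = 0 := by
  -- Descent from `N`: in the recurrence placed so that its `d`-th term is `R k`, the terms before
  -- it involve later entries, already known to vanish, and the terms after it have coefficient
  -- zero.
  have main : ∀ j k, N ≤ k + j → ν - d ≤ k → R k = 0 := by
    intro j
    induction j with
    | zero => exact fun k hk _ => hN k hk
    | succ j ih =>
      intro k hkj hk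
      have hs := h (k - (ν - d))
      rw [Finset.sum_eq_single d] at hs
      · rwa [hc, one_mul, show k - (ν - d) + ν - d = k by omega] at hs
      · intro i hi hid
        rcases lt_or_gt_of_ne hid with hlt | hgt
        · rw [ih (k - (ν - d) + ν - i) (by omega) (by omega), mul_zero]
        · rw [hc' i hgt, zero_mul]
      · intro hnot
        simp only [Finset.mem_range] at hnot
        omega
  exact main N k (by omega) hk

/-- Reversing the polynomial turns the recurrence into an evaluation at the shift `σ`, so that
polynomial identities, in particular Bézout's, act on sequences. -/
theorem aeval_apply_eq_sum {R : ℕ → ZMod 2} {P : (ZMod 2)[X]} {ν : ℕ}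
    (hP : P.natDegree ≤ ν) (σ : (ℕ → ZMod 2) →ₗ[ZMod 2] (ℕ → ZMod 2))
    (hσ : ∀ f n, σ f n = f (n + 1)) (n : ℕ) :
    aeval σ (reflect ν P) R n = ∑ i ∈ Finset.range (ν + 1), P.coeff i * R (n + ν - i) := by
  have hpow : ∀ (j : ℕ) (f : ℕ → ZMod 2) (n : ℕ), (σ ^ j) f n = f (n + j) := by
    intro j
    induction j with
    | zero => intro f n; simp
    | succ j ih =>
      intro f n
      rw [pow_succ', Module.End.mul_apply, hσ, ih, add_right_comm, add_assoc]
  have hdeg : (reflect ν P).natDegree < ν + 1 := by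
    have := natDegree_reflect_le (p := P) (N := ν)
    have := max_le le_rfl hP
    omega
  rw [aeval_eq_sum_range' hdeg, LinearMap.sum_apply, Finset.sum_apply, ← Finset.sum_range_reflect]
  refine Finset.sum_congr rfl fun i hi => ?_
  have hi' : i ≤ ν := Nat.lt_succ_iff.1 (Finset.mem_range.1 hi)
  have e1 : ν + 1 - 1 - i = ν - i := by omega
  rw [e1, LinearMap.smul_apply, Pi.smul_apply, hpow, coeff_reflect, revAt_le (Nat.sub_le _ _),
    smul_eq_mul, Nat.sub_sub_self hi', Nat.add_sub_assoc hi']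

/-- A sequence that satisfies the recurrences of two coprime polynomials vanishes eventually. -/
theorem eventually_zero_of_coprime {R : ℕ → ZMod 2} {P Q : (ZMod 2)[X]} {ν : ℕ}
    (hPQ : IsCoprime P Q) (hP : P.natDegree ≤ ν) (hQ : Q.natDegree ≤ ν)
    (h₁ : ∀ n, ∑ i ∈ Finset.range (ν + 1), P.coeff i * R (n + ν - i) = 0)
    (h₂ : ∀ n, ∑ i ∈ Finset.range (ν + 1), Q.coeff i * R (n + ν - i) = 0) :
    ∃ N, ∀ k, N ≤ k → R k = 0 := by
  obtain ⟨U, V, hUV⟩ := hPQ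
  let σ : (ℕ → ZMod 2) →ₗ[ZMod 2] (ℕ → ZMod 2) := LinearMap.funLeft (ZMod 2) (ZMod 2) Nat.succ
  have hσ : ∀ f n, σ f n = f (n + 1) := fun f n => rfl
  let K := max U.natDegree V.natDegree
  -- The reversal of `U * P + V * Q = 1` at degree `K + ν` has a power of `X` on the right, so this
  -- power of the shift annihilates `R`.
  have hr : reflect K U * reflect ν P + reflect K V * reflect ν Q = X ^ (K + ν) := by
    rw [← reflect_mul _ _ (le_max_left _ _) hP, ← reflect_mul _ _ (le_max_right _ _) hQ,
      ← reflect_add, hUV]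
    simp [K]
  have hp : aeval σ (reflect ν P) R = 0 := funext fun n =>
    (aeval_apply_eq_sum hP σ hσ n).trans (h₁ n)
  have hq : aeval σ (reflect ν Q) R = 0 := funext fun n =>
    (aeval_apply_eq_sum hQ σ hσ n).trans (h₂ n)
  have hX : (σ ^ (K + ν)) R = 0 := by
    have := congrArg (fun T => aeval σ T R) hr
    simpa [Module.End.mul_apply, hp, hq] using this.symm
  have hpow : ∀ (j n : ℕ), (σ ^ j) R n = R (n + j) := by
    intro j
    induction j with
    | zero => intro n; simp
    | succ j ih =>
      intro n
      rw [pow_succ', Module.End.mul_apply, hσ, ih, add_right_comm, add_assoc]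
  refine ⟨K + ν, fun k hk => ?_⟩
  have := congrFun hX (k - (K + ν))
  rwa [hpow, Nat.sub_add_cancel hk] at this

namespace RSCEncoder

variable (C : RSCEncoder)

theorem den_natDegree_pos : 0 < C.den.natDegree := by
  rw [Nat.pos_iff_ne_zero]
  intro h
  have h1 := eq_C_of_natDegree_eq_zero h
  rw [C.den_coeff_zero, C_1] at h1
  exact C.recursive h1

theorem memory_pos : 0 < C.memory := C.den_natDegree_pos.trans_le (le_max_right _ _)

/-- The state transition under zero input. -/
def idleState (s : C.State) : C.State := C.nextState s 0

/-- The parity bit under zero input. -/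
def idleParity (s : C.State) : ZMod 2 := C.codeBit s 0 1

/-- The contents of the last cell of the shift register over time, under zero input. -/
def registerSeq (s : C.State) (n : ℕ) : ZMod 2 :=
  (C.idleState^[n] s) ⟨C.memory - 1, Nat.sub_lt C.memory_pos one_pos⟩

/-- Apart from its first cell the register only shifts: the content of cell `i` reaches the last
cell after `memory - 1 - i` further steps. One scalar sequence thus records the whole trajectory. -/
theorem idleState_iterate_apply (s : C.State) (n : ℕ) (i : Fin C.memory) :
    (C.idleState^[n] s) i = C.registerSeq s (n + (C.memory - 1 - i)) := by
  have shift : ∀ (j : ℕ) (t : C.State) (i : ℕ) (h : i + j < C.memory),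
      (C.idleState^[j] t) ⟨i + j, h⟩ = t ⟨i, by omega⟩ := by
    intro j
    induction j with
    | zero => intro t i h; rfl
    | succ j ih =>
      intro t i h
      rw [Function.iterate_succ_apply', idleState]
      unfold nextState
      rw [if_neg (by simp)]
      exact ih t i (by omega)
  have hi := i.isLt
  have h := shift (C.memory - 1 - i) (C.idleState^[n] s) i (by omega)
  rw [← Function.iterate_add_apply] at h
  rw [registerSeq, add_comm n, ← h]
  exact congrArg _ (Fin.ext (by simp only; omega))

theorem registerInput_iterate (s : C.State) (n : ℕ) :
    C.registerInput (C.idleState^[n] s) 0 = C.registerSeq s (n + C.memory) := by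
  have h := C.idleState_iterate_apply s (n + 1) ⟨0, C.memory_pos⟩
  rw [Function.iterate_succ_apply', idleState, nextState, if_pos rfl] at h
  rw [h]
  congr 1
  have := C.memory_pos
  simp only
  omega

theorem sum_coeff_registerSeq (P : (ZMod 2)[X]) (s : C.State) (n : ℕ) :
    ∑ i ∈ Finset.range (C.memory + 1), P.coeff i * C.registerSeq s (n + C.memory - i) =
      P.coeff 0 * C.registerInput (C.idleState^[n] s) 0
        + ∑ i : Fin C.memory, P.coeff (i + 1) * (C.idleState^[n] s) i := by
  rw [Finset.sum_range_succ', add_comm, registerInput_iterate, Nat.sub_zero, Finset.sum_range]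
  congr 1
  refine Finset.sum_congr rfl fun i _ => ?_
  rw [idleState_iterate_apply]
  congr 2
  have := i.isLt
  omega

/-- With zero input the symbol fed into the register equals the feedback sum, so the two cancel in
characteristic 2. -/
theorem den_recurrence (s : C.State) (n : ℕ) :
    ∑ i ∈ Finset.range (C.memory + 1), C.den.coeff i * C.registerSeq s (n + C.memory - i) = 0 := by
  rw [sum_coeff_registerSeq, C.den_coeff_zero, one_mul, registerInput, zero_add]
  exact CharTwo.add_self_eq_zero _

theorem num_recurrence (s : C.State) (n : ℕ) :
    ∑ i ∈ Finset.range (C.memory + 1), C.num.coeff i * C.registerSeq s (n + C.memory - i) =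
      C.idleParity (C.idleState^[n] s) := by
  rw [sum_coeff_registerSeq]
  rfl

theorem idleState_zero : C.idleState 0 = 0 := C.nextState_zero

theorem idleState_iterate_zero (n : ℕ) : C.idleState^[n] 0 = 0 :=
  Function.iterate_fixed C.idleState_zero n

theorem registerSeq_eventually_zero {s : C.State} {N : ℕ} (h : C.idleState^[N] s = 0) :
    ∀ k, N ≤ k → C.registerSeq s k = 0 := by
  intro k hk
  obtain ⟨j, rfl⟩ := Nat.exists_eq_add_of_le' hk
  rw [registerSeq, Function.iterate_add_apply, h, idleState_iterate_zero]
  rfl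

theorem coeff_natDegree_eq_one {P : (ZMod 2)[X]} (hP : P ≠ 0) : P.coeff P.natDegree = 1 := by
  have h : P.leadingCoeff ≠ 0 := leadingCoeff_ne_zero.2 hP
  rw [← leadingCoeff]
  generalize P.leadingCoeff = c at h
  revert c
  decide

/-- The trellis is observable: the parity bits under zero input determine the state. -/
theorem eq_zero_of_idleParity {s : C.State} (h : ∀ n, C.idleParity (C.idleState^[n] s) = 0) :
    s = 0 := by
  have hnum : ∀ n, ∑ i ∈ Finset.range (C.memory + 1),
      C.num.coeff i * C.registerSeq s (n + C.memory - i) = 0 :=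
    fun n => (C.num_recurrence s n).trans (h n)
  obtain ⟨N, hN⟩ := eventually_zero_of_coprime C.coprime (le_max_left _ _) (le_max_right _ _)
    hnum (C.den_recurrence s)
  have hR : ∀ k, C.registerSeq s k = 0 := by
    intro k
    -- One of the two polynomials has degree exactly `memory`. Its recurrence reaches back to index
    -- 0, which upgrades eventual vanishing to vanishing everywhere.
    have aux : ∀ P : (ZMod 2)[X], P.natDegree = C.memory →
        (∀ n, ∑ i ∈ Finset.range (C.memory + 1),
          P.coeff i * C.registerSeq s (n + C.memory - i) = 0) → C.registerSeq s k = 0 := by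
      intro P hP hrec
      refine eq_zero_of_recurrence (c := P.coeff) (d := C.memory) le_rfl ?_
        (fun i hi => coeff_eq_zero_of_natDegree_lt (hP ▸ hi)) hrec hN (by omega)
      rw [← hP]
      refine coeff_natDegree_eq_one fun h0 => ?_
      have := C.memory_pos
      rw [h0, natDegree_zero] at hP
      omega
    rcases max_choice C.num.natDegree C.den.natDegree with hm | hm
    · exact aux C.num hm.symm hnum
    · exact aux C.den hm.symm (C.den_recurrence s)
  funext i
  exact (C.idleState_iterate_apply s 0 i).trans (hR _)

/-- There are finitely many states, so the first times at which nonzero states reveal themselves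
have a common bound. -/
theorem exists_observability_horizon :
    ∃ N, ∀ s : C.State, (∀ n < N, C.idleParity (C.idleState^[n] s) = 0) → s = 0 := by
  classical
  have h : ∀ s : C.State, ∃ n, s ≠ 0 → C.idleParity (C.idleState^[n] s) ≠ 0 := by
    intro s
    by_contra hcon
    push Not at hcon
    exact (hcon 0).1 (C.eq_zero_of_idleParity fun n => (hcon n).2)
  choose n hn using h
  refine ⟨Finset.univ.sup n + 1, fun s hs => ?_⟩
  by_contra h0
  exact hn s h0 (hs _ (Nat.lt_succ_of_le (Finset.le_sup (Finset.mem_univ s))))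

/-- The response of a recursive encoder to a single input bit never dies out. -/
theorem idleState_iterate_ne_zero (n : ℕ) : C.idleState^[n] (C.nextState 0 1) ≠ 0 := by
  intro h
  -- If the response died out, the denominator recurrence, of positive degree, would force the entry
  -- at index `memory - 1` to vanish. That entry is the symbol 1 that the input has just put into
  -- the first cell.
  have hz := eq_zero_of_recurrence (d := C.den.natDegree) (le_max_right _ _)
    (coeff_natDegree_eq_one fun h0 => by simpa [h0] using C.den_coeff_zero)
    (fun i hi => coeff_eq_zero_of_natDegree_lt hi) (C.den_recurrence (C.nextState 0 1))
    (C.registerSeq_eventually_zero h) (k := C.memory - 1)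
    (Nat.sub_le_sub_left C.den_natDegree_pos _)
  have h1 := C.idleState_iterate_apply (C.nextState 0 1) 0 ⟨0, C.memory_pos⟩
  simp only [zero_add, Nat.sub_zero] at h1
  rw [hz] at h1
  simp [nextState, registerInput] at h1

/-! ### Reset of the metric vectors -/

theorem mem_forwardStep {e : Fin 2 → Bool} {A : Finset C.State} {s : C.State} :
    s ∈ C.forwardStep e A ↔ ∃ s' ∈ A, ∃ u, C.nextState s' u = s ∧ C.Compatible e s' u := by
  simp [forwardStep]

theorem mem_backwardStep {e : Fin 2 → Bool} {B : Finset C.State} {s : C.State} :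
    s ∈ C.backwardStep e B ↔ ∃ u, C.nextState s u ∈ B ∧ C.Compatible e s u := by
  simp [backwardStep]

theorem compatible_none {s : C.State} {u : ZMod 2} :
    C.Compatible ![false, false] s u ↔ u = 0 ∧ C.idleParity s = 0 := by
  constructor
  · intro h
    have h0 : u = 0 := h 0 rfl
    subst h0
    exact ⟨rfl, h 1 rfl⟩
  · rintro ⟨rfl, h⟩ l _
    fin_cases l
    · rfl
    · exact h

theorem eq_zero_of_compatible {e : Fin 2 → Bool} (he : e 0 = false) {s : C.State} {u : ZMod 2}
    (h : C.Compatible e s u) : u = 0 := h 0 he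

theorem compatible_all (s : C.State) (u : ZMod 2) : C.Compatible ![true, true] s u := by
  intro l hl
  fin_cases l <;> simp at hl

theorem zero_mem_iterate {step : Finset C.State → Finset C.State} {A : Finset C.State}
    (hstep : ∀ A, 0 ∈ A → 0 ∈ step A) (hA : 0 ∈ A) (n : ℕ) : 0 ∈ step^[n] A := by
  induction n with
  | zero => exact hA
  | succ n ih => rw [Function.iterate_succ_apply']; exact hstep _ ih

theorem zero_mem_forwardStep_of_mem {e : Fin 2 → Bool} {A : Finset C.State} (h : 0 ∈ A) :
    0 ∈ C.forwardStep e A :=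
  C.mem_forwardStep.2 ⟨0, h, 0, C.nextState_zero, C.compatible_zero e⟩

theorem zero_mem_backwardStep_of_mem {e : Fin 2 → Bool} {A : Finset C.State} (h : 0 ∈ A) :
    0 ∈ C.backwardStep e A :=
  C.mem_backwardStep.2 ⟨0, C.nextState_zero.symm ▸ h, C.compatible_zero e⟩

/-- A surviving state is the end of a path with zero inputs and zero parities. By observability the
path starts in the zero state, hence it also ends there. -/
theorem exists_forwardStep_reset :
    ∃ N, ∀ A : Finset C.State, 0 ∈ A → (C.forwardStep ![false, false])^[N] A = {0} := by
  obtain ⟨N, hN⟩ := C.exists_observability_horizon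
  have key : ∀ n (A : Finset C.State) (s : C.State), s ∈ (C.forwardStep ![false, false])^[n] A →
      ∃ s', C.idleState^[n] s' = s ∧ ∀ k < n, C.idleParity (C.idleState^[k] s') = 0 := by
    intro n A
    induction n with
    | zero => exact fun s _ => ⟨s, rfl, fun k hk => absurd hk (Nat.not_lt_zero k)⟩
    | succ n ih =>
      intro s hs
      rw [Function.iterate_succ_apply', mem_forwardStep] at hs
      obtain ⟨t, ht, u, hu, hc⟩ := hs
      obtain ⟨rfl, hpar⟩ := C.compatible_none.1 hc
      obtain ⟨s', rfl, hs'⟩ := ih t ht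
      refine ⟨s', by rw [Function.iterate_succ_apply']; exact hu, fun k hk => ?_⟩
      rcases Nat.lt_succ_iff_lt_or_eq.1 hk with hk | rfl
      · exact hs' k hk
      · exact hpar
  refine ⟨N, fun A hA => ?_⟩
  rw [Finset.eq_singleton_iff_unique_mem]
  refine ⟨C.zero_mem_iterate (fun _ => C.zero_mem_forwardStep_of_mem) hA N,
    fun s hs => ?_⟩
  obtain ⟨s', rfl, hs'⟩ := key N A s hs
  rw [hN s' hs', idleState_iterate_zero]

/-- Here a surviving state is the start of such a path, so observability applies to it directly. -/
theorem exists_backwardStep_reset :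
    ∃ N, ∀ A : Finset C.State, 0 ∈ A → (C.backwardStep ![false, false])^[N] A = {0} := by
  obtain ⟨N, hN⟩ := C.exists_observability_horizon
  have key : ∀ n (A : Finset C.State) (s : C.State), s ∈ (C.backwardStep ![false, false])^[n] A →
      ∀ k < n, C.idleParity (C.idleState^[k] s) = 0 := by
    intro n A
    induction n with
    | zero => exact fun s _ k hk => absurd hk (Nat.not_lt_zero k)
    | succ n ih =>
      intro s hs k hk
      rw [Function.iterate_succ_apply', mem_backwardStep] at hs
      obtain ⟨u, hu, hc⟩ := hs
      obtain ⟨rfl, hpar⟩ := C.compatible_none.1 hc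
      cases k with
      | zero => exact hpar
      | succ k =>
        rw [Function.iterate_succ_apply]
        exact ih _ hu k (by omega)
  refine ⟨N, fun A hA => ?_⟩
  rw [Finset.eq_singleton_iff_unique_mem]
  exact ⟨C.zero_mem_iterate (fun _ => C.zero_mem_backwardStep_of_mem) hA N,
    fun s hs => hN s (key N A s hs)⟩

theorem nextState_apply_zero (s : C.State) (u : ZMod 2) (i : Fin C.memory) (hi : (i : ℕ) = 0) :
    C.nextState s u i = C.registerInput s u := if_pos hi

theorem nextState_apply_succ (s : C.State) (u : ZMod 2) (i : Fin C.memory) (hi : (i : ℕ) ≠ 0) :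
    C.nextState s u i = s ⟨(i : ℕ) - 1, lt_of_le_of_lt (Nat.sub_le _ _) i.isLt⟩ := if_neg hi

theorem exists_registerInput_eq (s : C.State) (r : ZMod 2) : ∃ u, C.registerInput s u = r :=
  ⟨r - ∑ i : Fin C.memory, C.den.coeff (i + 1) * s i, sub_add_cancel _ _⟩

/-- Controllability: the input bit can produce any register symbol, and erased bits exclude no edge.
After `k` steps from the zero state the first `k` cells are arbitrary. -/
theorem forwardStep_fill {A : Finset C.State} (hA : 0 ∈ A) :
    (C.forwardStep ![true, true])^[C.memory] A = Finset.univ := by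
  have key : ∀ k (s : C.State), (∀ i : Fin C.memory, k ≤ (i : ℕ) → s i = 0) →
      s ∈ (C.forwardStep ![true, true])^[k] A := by
    intro k
    induction k with
    | zero =>
      intro s hs
      have : s = 0 := funext fun i => hs i (Nat.zero_le _)
      exact this ▸ hA
    | succ k ih =>
      intro s hs
      rw [Function.iterate_succ_apply', mem_forwardStep]
      -- The predecessor of `s` is `s` shifted back by one cell; the symbol that drops out of its
      -- last cell is taken to be 0.
      let s' : C.State := fun i => if h : (i : ℕ) + 1 < C.memory then s ⟨(i : ℕ) + 1, h⟩ else 0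
      obtain ⟨u, hu⟩ := C.exists_registerInput_eq s' (s ⟨0, C.memory_pos⟩)
      refine ⟨s', ih s' fun i hi => ?_, u, funext fun i => ?_, C.compatible_all _ _⟩
      · simp only [s']
        split_ifs with h
        · exact hs _ (Nat.succ_le_succ hi)
        · rfl
      · by_cases hi : (i : ℕ) = 0
        · rw [C.nextState_apply_zero _ _ _ hi, hu]
          exact congrArg s (Fin.ext hi.symm)
        · rw [C.nextState_apply_succ _ _ _ hi]
          have hi' := i.isLt
          simp only [s']
          rw [dif_pos (by omega)]
          exact congrArg s (Fin.ext (by simp only; omega))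
  exact Finset.eq_univ_of_forall fun s => key _ s fun i hi => absurd i.isLt (not_lt.2 hi)

/-- Feeding zeros into the register pushes all nonzero symbols out of it, so every state leads to
the zero state within `memory` steps. -/
theorem backwardStep_fill {A : Finset C.State} (hA : 0 ∈ A) :
    (C.backwardStep ![true, true])^[C.memory] A = Finset.univ := by
  have key : ∀ k (s : C.State), (∀ i : Fin C.memory, (i : ℕ) + k < C.memory → s i = 0) →
      s ∈ (C.backwardStep ![true, true])^[k] A := by
    intro k
    induction k with
    | zero =>
      intro s hs
      have : s = 0 := funext fun i => hs i i.isLt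
      exact this ▸ hA
    | succ k ih =>
      intro s hs
      rw [Function.iterate_succ_apply', mem_backwardStep]
      obtain ⟨u, hu⟩ := C.exists_registerInput_eq s 0
      refine ⟨u, ih _ fun i hi => ?_, C.compatible_all _ _⟩
      by_cases hi0 : (i : ℕ) = 0
      · rw [C.nextState_apply_zero _ _ _ hi0, hu]
      · rw [C.nextState_apply_succ _ _ _ hi0]
        exact hs _ (by simp only; omega)
  exact Finset.eq_univ_of_forall fun s => key _ s fun i hi => absurd hi (by omega)

/-! ### Properties of the transfer function -/

/-- The erasure probabilities in the cube for which some erasure pattern that resets the metric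
vectors has positive probability. -/
def resetRegion : Set (Fin 2 → ℝ) :=
  {p | p ∈ unitCube 2 ∧ (p 0 < 1 ∧ p 1 < 1 ∨ 0 < p 0 ∧ 0 < p 1)}

/-- The two alternatives give positive probability to the absence of erasures, which resets to
`{0}`, and to total erasure, which resets to the set of all states. The cube minus `resetRegion`
consists of the corners (1, 0) and (0, 1). -/
theorem contDiffWithinAt_laws {k : WithTop ℕ∞} {p : Fin 2 → ℝ} (hp : p ∈ resetRegion)
    (A : Finset C.State) :
    ContDiffWithinAt ℝ k (fun q => C.forwardLaw q A) (unitCube 2) p ∧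
      ContDiffWithinAt ℝ k (fun q => C.backwardLaw q A) (unitCube 2) p := by
  obtain ⟨hp, h | h⟩ := hp
  · have hw : 0 < erasureWeight p ![false, false] := by
      simp only [erasureWeight, Fin.prod_univ_two]
      simpa using mul_pos (sub_pos.2 h.1) (sub_pos.2 h.2)
    obtain ⟨N, hN⟩ := C.exists_forwardStep_reset
    obtain ⟨N', hN'⟩ := C.exists_backwardStep_reset
    exact ⟨contDiffWithinAt_steadyState C.forwardStep_mono C.zero_mem_forwardStep hp hw hN A,
      contDiffWithinAt_steadyState C.backwardStep_mono C.zero_mem_backwardStep hp hw hN' A⟩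
  · have hw : 0 < erasureWeight p ![true, true] := by
      simp only [erasureWeight, Fin.prod_univ_two]
      simpa using mul_pos h.1 h.2
    exact ⟨contDiffWithinAt_steadyState C.forwardStep_mono C.zero_mem_forwardStep hp hw
        (fun B hB => C.forwardStep_fill hB) A,
      contDiffWithinAt_steadyState C.backwardStep_mono C.zero_mem_backwardStep hp hw
        (fun B hB => C.backwardStep_fill hB) A⟩

theorem contDiffWithinAt_transfer {k : WithTop ℕ∞} {p : Fin 2 → ℝ} (hp : p ∈ resetRegion)
    (l : Fin 2) : ContDiffWithinAt ℝ k (C.transfer l) (unitCube 2) p := by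
  refine ContDiffWithinAt.sum fun A _ => (C.contDiffWithinAt_laws hp A).1.mul
    (ContDiffWithinAt.sum fun B _ => ContDiffWithinAt.mul (ContDiff.contDiffWithinAt ?_)
      (C.contDiffWithinAt_laws hp B).2)
  refine ContDiff.sum fun e _ => ?_
  split_ifs
  · exact contDiff_erasureWeight e
  · exact contDiff_const

/-! ### Monotonicity and range of the transfer function -/

theorem Undetermined.mono {l : Fin 2} {A A' B B' : Finset C.State} {e e' : Fin 2 → Bool}
    (hA : A ⊆ A') (hB : B ⊆ B') (he : e ≤ e') (h : C.Undetermined l A B e) :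
    C.Undetermined l A' B' e' := by
  intro b
  obtain ⟨s, hs, u, hu, hb, hl⟩ := h b
  refine ⟨s, hA hs, u, hB hu, hb, fun l' hl' hel' => hl l' hl' ?_⟩
  have := he l'
  rw [hel'] at this
  exact Bool.eq_false_of_le_false this

theorem Compatible.mono {e e' : Fin 2 → Bool} (he : e ≤ e') {s : C.State} {u : ZMod 2}
    (h : C.Compatible e s u) : C.Compatible e' s u := by
  intro l hl
  have := he l
  rw [hl] at this
  exact h l (Bool.eq_false_of_le_false this)

theorem forwardStep_mono_pattern : Monotone C.forwardStep := by
  intro e e' he A s hs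
  obtain ⟨s', hs', u, hu, hc⟩ := C.mem_forwardStep.1 hs
  exact C.mem_forwardStep.2 ⟨s', hs', u, hu, Compatible.mono C he hc⟩

theorem backwardStep_mono_pattern : Monotone C.backwardStep := by
  intro e e' he A s hs
  obtain ⟨u, hu, hc⟩ := C.mem_backwardStep.1 hs
  exact C.mem_backwardStep.2 ⟨u, hu, Compatible.mono C he hc⟩

theorem outputErasure_mono {l : Fin 2} {p p' : Fin 2 → ℝ} (hp : p ∈ unitCube 2)
    (hp' : p' ∈ unitCube 2) (hpp' : p ≤ p') {A A' B B' : Finset C.State} (hA : A ⊆ A')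
    (hB : B ⊆ B') : C.outputErasure l p A B ≤ C.outputErasure l p' A' B' := by
  classical
  have heq : ∀ (q : Fin 2 → ℝ) (A B : Finset C.State), C.outputErasure l q A B
      = ∑ e, erasureWeight q e * if C.Undetermined l A B e then 1 else 0 := by
    intro q A B
    refine Finset.sum_congr rfl fun e _ => ?_
    split_ifs <;> simp
  have hind : ∀ {A A' B B' : Finset C.State} {e e' : Fin 2 → Bool}, A ⊆ A' → B ⊆ B' → e ≤ e' →
      (if C.Undetermined l A B e then (1 : ℝ) else 0)
        ≤ if C.Undetermined l A' B' e' then 1 else 0 := by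
    intro A A' B B' e e' h₁ h₂ h₃
    by_cases h : C.Undetermined l A B e
    · rw [if_pos h, if_pos (Undetermined.mono C h₁ h₂ h₃ h)]
    · rw [if_neg h]
      split_ifs <;> norm_num
  rw [heq, heq]
  calc _ ≤ ∑ e, erasureWeight p' e * (if C.Undetermined l A B e then 1 else 0) :=
        sum_erasureWeight_mul_mono hp hp' hpp' fun e e' he => hind subset_rfl subset_rfl he
    _ ≤ _ := Finset.sum_le_sum fun e _ => mul_le_mul_of_nonneg_left (hind hA hB le_rfl)
        (erasureWeight_nonneg (mem_unitCube.1 hp') e)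

theorem outputErasure_mem_Icc {l : Fin 2} {p : Fin 2 → ℝ} (hp : p ∈ unitCube 2)
    (A B : Finset C.State) : C.outputErasure l p A B ∈ Icc (0 : ℝ) 1 := by
  have hw := erasureWeight_nonneg (mem_unitCube.1 hp)
  constructor
  · refine Finset.sum_nonneg fun e _ => ?_
    split_ifs
    · exact hw e
    · exact le_rfl
  · rw [← sum_erasureWeight p]
    refine Finset.sum_le_sum fun e _ => ?_
    split_ifs
    · exact le_rfl
    · exact hw e

theorem transfer_mem_Icc {l : Fin 2} {p : Fin 2 → ℝ} (hp : p ∈ unitCube 2) :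
    C.transfer l p ∈ Icc (0 : ℝ) 1 := by
  have hF := steadyState_nonneg C.forwardStep_mono C.zero_mem_forwardStep hp
  have hB := steadyState_nonneg C.backwardStep_mono C.zero_mem_backwardStep hp
  have sF := sum_steadyState C.forwardStep_mono C.zero_mem_forwardStep hp
  have sB := sum_steadyState C.backwardStep_mono C.zero_mem_backwardStep hp
  constructor
  · exact Finset.sum_nonneg fun A _ => mul_nonneg (hF A) (Finset.sum_nonneg fun B _ =>
      mul_nonneg (C.outputErasure_mem_Icc hp A B).1 (hB B))
  · calc C.transfer l p ≤ ∑ A, C.forwardLaw p A * 1 :=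
          Finset.sum_le_sum fun A _ => mul_le_mul_of_nonneg_left ?_ (hF A)
      _ = 1 := by simpa [forwardLaw] using sF
    calc (C.outputErasure l p *ᵥ C.backwardLaw p) A ≤ ∑ B, 1 * C.backwardLaw p B :=
          Finset.sum_le_sum fun B _ =>
            mul_le_mul_of_nonneg_right (C.outputErasure_mem_Icc hp A B).2 (hB B)
      _ = 1 := by simpa [backwardLaw] using sB

/-- The output matrix, the backward law and the forward law are replaced in this order. Each law is
replaced inside the expectation of a function monotone in its metric vector. -/
theorem transfer_mono {l : Fin 2} {p p' : Fin 2 → ℝ} (hp : p ∈ unitCube 2) (hp' : p' ∈ unitCube 2)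
    (hpp' : p ≤ p') : C.transfer l p ≤ C.transfer l p' := by
  have hF := steadyState_nonneg C.forwardStep_mono C.zero_mem_forwardStep hp
  have hB := steadyState_nonneg C.backwardStep_mono C.zero_mem_backwardStep hp
  have hB' := steadyState_nonneg C.backwardStep_mono C.zero_mem_backwardStep hp'
  calc C.transfer l p
      ≤ C.forwardLaw p ⬝ᵥ (C.outputErasure l p' *ᵥ C.backwardLaw p') := by
        refine Finset.sum_le_sum fun A _ => mul_le_mul_of_nonneg_left ?_ (hF A)
        calc (C.outputErasure l p *ᵥ C.backwardLaw p) A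
            ≤ C.outputErasure l p' A ⬝ᵥ C.backwardLaw p :=
              Finset.sum_le_sum fun B _ => mul_le_mul_of_nonneg_right
                (C.outputErasure_mono hp hp' hpp' subset_rfl subset_rfl) (hB B)
          _ ≤ C.outputErasure l p' A ⬝ᵥ C.backwardLaw p' :=
              dotProduct_steadyState_mono C.backwardStep_mono C.zero_mem_backwardStep hp hp' hpp'
                C.backwardStep_mono_pattern
                fun B B' h => C.outputErasure_mono hp' hp' le_rfl subset_rfl h
    _ ≤ C.transfer l p' := by
        unfold transfer
        rw [dotProduct_comm, dotProduct_comm (C.forwardLaw p')]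
        refine dotProduct_steadyState_mono C.forwardStep_mono C.zero_mem_forwardStep hp hp' hpp'
          C.forwardStep_mono_pattern fun A A' h => ?_
        exact Finset.sum_le_sum fun B _ => mul_le_mul_of_nonneg_right
          (C.outputErasure_mono hp' hp' le_rfl h subset_rfl) (hB' B)

theorem vec_mem_unitCube {p₁ p₂ : ℝ} (h₁ : p₁ ∈ Icc (0 : ℝ) 1) (h₂ : p₂ ∈ Icc (0 : ℝ) 1) :
    ![p₁, p₂] ∈ unitCube 2 := by
  rw [mem_unitCube]
  intro i
  fin_cases i
  · exact h₁
  · exact h₂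

theorem sysTransfer_mem_Icc {p₁ p₂ : ℝ} (h₁ : p₁ ∈ Icc (0 : ℝ) 1) (h₂ : p₂ ∈ Icc (0 : ℝ) 1) :
    C.sysTransfer p₁ p₂ ∈ Icc (0 : ℝ) 1 := C.transfer_mem_Icc (vec_mem_unitCube h₁ h₂)

theorem sysTransfer_mono {p₁ p₂ p₁' p₂' : ℝ} (h₁ : p₁ ∈ Icc (0 : ℝ) 1) (h₂ : p₂ ∈ Icc (0 : ℝ) 1)
    (h₁' : p₁' ∈ Icc (0 : ℝ) 1) (h₂' : p₂' ∈ Icc (0 : ℝ) 1) (h : p₁ ≤ p₁') (h' : p₂ ≤ p₂') :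
    C.sysTransfer p₁ p₂ ≤ C.sysTransfer p₁' p₂' := by
  refine C.transfer_mono (vec_mem_unitCube h₁ h₂) (vec_mem_unitCube h₁' h₂') fun i => ?_
  fin_cases i
  · exact h
  · exact h'

theorem contDiffWithinAt_sysTransfer {E : Type*} [NormedAddCommGroup E] [NormedSpace ℝ E]
    {k : WithTop ℕ∞} {a b : E → ℝ} {s : Set E} {x : E} (hx : x ∈ s)
    (ha : ContDiffWithinAt ℝ k a s x) (hb : ContDiffWithinAt ℝ k b s x)
    (hs : ∀ y ∈ s, a y ∈ Icc (0 : ℝ) 1 ∧ b y ∈ Icc (0 : ℝ) 1)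
    (h : a x < 1 ∧ b x < 1 ∨ 0 < a x ∧ 0 < b x) :
    ContDiffWithinAt ℝ k (fun y => C.sysTransfer (a y) (b y)) s x := by
  have hv : ContDiffWithinAt ℝ k (fun y => ![a y, b y]) s x := by
    rw [contDiffWithinAt_pi]
    intro i
    fin_cases i
    · exact ha
    · exact hb
  exact ContDiffWithinAt.comp x (C.contDiffWithinAt_transfer
    ⟨vec_mem_unitCube (hs x hx).1 (hs x hx).2, h⟩ 0) hv
    fun y hy => vec_mem_unitCube (hs y hy).1 (hs y hy).2

/-- If the systematic bits are known, then nothing remains undetermined. -/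
theorem sysTransfer_zero_left (p₂ : ℝ) : C.sysTransfer 0 p₂ = 0 := by
  have he : ∀ e, erasureWeight ![0, p₂] e ≠ 0 → e 0 = false := by
    intro e h
    by_contra h0
    exact h (Finset.prod_eq_zero (Finset.mem_univ 0) (by simp [h0]))
  -- With all inputs known to be zero, the forward metric stays within `{0}` and the backward metric
  -- contains only states that zero input drives to 0. These are statements on supports and hold for
  -- arbitrary `p₂`.
  have hF : ∀ A, ¬ A ⊆ {0} → C.forwardLaw ![0, p₂] A = 0 := fun A hA =>
    steadyState_eq_zero_of_not (P := fun A => A ⊆ {0}) subset_rfl (fun e h A hA s hs => by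
      obtain ⟨s', hs', u, rfl, hc⟩ := C.mem_forwardStep.1 hs
      rw [C.eq_zero_of_compatible (he e h) hc, Finset.mem_singleton.1 (hA hs'), C.nextState_zero]
      exact Finset.mem_singleton_self 0) hA
  have hB : ∀ B, (¬ ∀ s ∈ B, ∃ n, C.idleState^[n] s = 0) → C.backwardLaw ![0, p₂] B = 0 :=
    fun B hB => steadyState_eq_zero_of_not
      (P := fun B : Finset C.State => ∀ s ∈ B, ∃ n, C.idleState^[n] s = 0)
      (fun s hs => ⟨0, Finset.mem_singleton.1 hs⟩) (fun e h B hB s hs => by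
        obtain ⟨u, hu, hc⟩ := C.mem_backwardStep.1 hs
        rw [C.eq_zero_of_compatible (he e h) hc] at hu
        obtain ⟨n, hn⟩ := hB _ hu
        exact ⟨n + 1, hn⟩) hB
  refine Finset.sum_eq_zero fun A _ => ?_
  by_cases hA : A ⊆ {0}
  · refine mul_eq_zero_of_right _ (Finset.sum_eq_zero fun B _ => ?_)
    by_cases hB' : ∀ s ∈ B, ∃ n, C.idleState^[n] s = 0
    · refine mul_eq_zero_of_left (Finset.sum_eq_zero fun e _ => if_neg fun h => ?_) _
      -- An undetermined bit would need an edge with input 1 from the zero state into such a state,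
      -- which a recursive encoder excludes.
      obtain ⟨s, hs, u, hu, hb, -⟩ := h 1
      have hu1 : u = 1 := hb
      rw [Finset.mem_singleton.1 (hA hs), hu1] at hu
      obtain ⟨n, hn⟩ := hB' _ hu
      exact C.idleState_iterate_ne_zero n hn
    · exact mul_eq_zero_of_right _ (hB B hB')
  · exact mul_eq_zero_of_left (hF A hA) _

end RSCEncoder

/-! ### Threshold saturation on the half-line -/

/-- The average of the values at the positions `t - m, …, t`. -/
noncomputable def backAverage (m : ℕ) (b : ℤ → ℝ) (t : ℤ) : ℝ :=
  (1 / ((m : ℝ) + 1)) * ∑ k ∈ Finset.range (m + 1), b (t - k)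

/-- The average of the values at the positions `t, …, t + m`. -/
noncomputable def frontAverage (m : ℕ) (b : ℤ → ℝ) (t : ℤ) : ℝ :=
  (1 / ((m : ℝ) + 1)) * ∑ j ∈ Finset.range (m + 1), b (t + j)

/-- One component of the coupled recursion on the half-line of positions `t ≥ 1`. -/
noncomputable def halfLineStep (m : ℕ) (φ : ℝ → ℝ) (b : ℤ → ℝ) (t : ℤ) : ℝ :=
  if 1 ≤ t then frontAverage m (fun s => φ (backAverage m b s)) t else 0

/-! ### Window averages, summation by parts and Riemann sums -/

section Average

variable {m : ℕ}

theorem one_div_succ_nonneg (m : ℕ) : 0 ≤ 1 / ((m : ℝ) + 1) := by positivity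

theorem average_const (m : ℕ) (c : ℝ) :
    (1 / ((m : ℝ) + 1)) * ∑ _k ∈ Finset.range (m + 1), c = c := by
  have : (m : ℝ) + 1 ≠ 0 := by positivity
  rw [Finset.sum_const, Finset.card_range, nsmul_eq_mul]
  push_cast
  field_simp

theorem average_mono {f g : ℕ → ℝ} (h : ∀ k, f k ≤ g k) :
    (1 / ((m : ℝ) + 1)) * ∑ k ∈ Finset.range (m + 1), f k
      ≤ (1 / ((m : ℝ) + 1)) * ∑ k ∈ Finset.range (m + 1), g k :=
  mul_le_mul_of_nonneg_left (Finset.sum_le_sum fun k _ => h k) (one_div_succ_nonneg m)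

theorem average_mem_Icc {f : ℕ → ℝ} {c d : ℝ} (h : ∀ k, f k ∈ Icc c d) :
    (1 / ((m : ℝ) + 1)) * ∑ k ∈ Finset.range (m + 1), f k ∈ Icc c d :=
  ⟨(average_const m c).symm.le.trans (average_mono fun k => (h k).1),
    (average_mono fun k => (h k).2).trans (average_const m d).le⟩

theorem tendsto_average {ι : Type*} {l : Filter ι} {f : ι → ℕ → ℝ} {c : ℕ → ℝ}
    (h : ∀ k, Tendsto (fun i => f i k) l (𝓝 (c k))) :
    Tendsto (fun i => (1 / ((m : ℝ) + 1)) * ∑ k ∈ Finset.range (m + 1), f i k) l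
      (𝓝 ((1 / ((m : ℝ) + 1)) * ∑ k ∈ Finset.range (m + 1), c k)) :=
  (tendsto_finsetSum _ fun k _ => h k).const_mul _

/-- Consecutive windows differ in one entry at each end. For values in [0, 1] the increments are
therefore at most 1/(m+1), which is the mesh of the Riemann sums below. -/
theorem backAverage_sub (b : ℤ → ℝ) (s : ℤ) :
    backAverage m b (s + 1) - backAverage m b s = (1 / ((m : ℝ) + 1)) * (b (s + 1) - b (s - m)) := by
  rw [backAverage, backAverage, ← mul_sub, ← Finset.sum_sub_distrib]
  have h := Finset.sum_range_sub' (fun k : ℕ => b (s + 1 - k)) (m + 1)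
  have e : s + 1 - ((m + 1 : ℕ) : ℤ) = s - m := by push_cast; ring
  rw [e] at h
  simp only [Nat.cast_zero, sub_zero] at h
  rw [← h]
  congr 1
  refine Finset.sum_congr rfl fun k _ => ?_
  congr 2
  push_cast
  ring

/-- Summation by parts: the front average is adjoint to the back average. Shifting the index by `j ≤
m` lands in the first `N + m` positions, and the extra terms there are nonnegative. -/
theorem sum_frontAverage_mul_le_sum {b : ℤ → ℝ} (hb : Monotone b) {H : ℤ → ℝ} (hH : ∀ s, 0 ≤ H s)
    (N : ℕ) :
    ∑ n ∈ Finset.range N, frontAverage m H (n + 1) * (b (n + 1) - b n) ≤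
      ∑ s ∈ Finset.range (N + m), H (s + 1) * (backAverage m b (s + 1) - backAverage m b s) := by
  have hj : ∀ j ∈ Finset.range (m + 1),
      ∑ n ∈ Finset.range N, H ((n : ℤ) + 1 + j) * (b (n + 1) - b n) ≤
        ∑ s ∈ Finset.range (N + m), H ((s : ℤ) + 1) * (b (s + 1 - j) - b (s - j)) := by
    intro j hj
    have hj' := Finset.mem_range.1 hj
    have h := Finset.sum_Ico_add' (fun s : ℕ => H ((s : ℤ) + 1) * (b (s + 1 - j) - b (s - j))) 0 N j
    rw [← Finset.range_eq_Ico] at h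
    calc _ = ∑ s ∈ Finset.Ico (0 + j) (N + j), H ((s : ℤ) + 1) * (b (s + 1 - j) - b (s - j)) := by
          rw [← h]
          refine Finset.sum_congr rfl fun n _ => ?_
          push_cast
          congr 2
          · ring
          · congr 1
            ring
          · congr 1
            ring
      _ ≤ _ := by
          refine Finset.sum_le_sum_of_subset_of_nonneg (fun s hs => ?_) fun s _ _ =>
            mul_nonneg (hH _) (sub_nonneg.2 (hb (by omega)))
          rw [Finset.mem_Ico] at hs
          rw [Finset.mem_range]
          omega
  calc _ = (1 / ((m : ℝ) + 1)) * ∑ j ∈ Finset.range (m + 1), ∑ n ∈ Finset.range N,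
          H ((n : ℤ) + 1 + j) * (b (n + 1) - b n) := by
        rw [Finset.sum_comm, Finset.mul_sum]
        refine Finset.sum_congr rfl fun n _ => ?_
        rw [frontAverage, mul_assoc, Finset.sum_mul]
    _ ≤ (1 / ((m : ℝ) + 1)) * ∑ j ∈ Finset.range (m + 1), ∑ s ∈ Finset.range (N + m),
          H ((s : ℤ) + 1) * (b (s + 1 - j) - b (s - j)) :=
        mul_le_mul_of_nonneg_left (Finset.sum_le_sum hj) (one_div_succ_nonneg m)
    _ = _ := by
        rw [Finset.sum_comm, Finset.mul_sum]
        refine Finset.sum_congr rfl fun s _ => ?_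
        rw [← Finset.mul_sum, Finset.sum_sub_distrib, backAverage, backAverage]
        ring

/-- A Riemann sum of a monotone function exceeds the integral by at most the mesh size times the
total variation. -/
theorem sum_frontAverage_mul_le_integral {h : ℝ → ℝ} (hh : Monotone h)
    (h01 : ∀ x, h x ∈ Icc (0 : ℝ) 1) {b : ℤ → ℝ} (hb : Monotone b) (hb0 : ∀ t ≤ 0, b t = 0)
    {β : ℝ} (hβ : ∀ t, b t ≤ β) (hβ1 : β ≤ 1) (N : ℕ) :
    ∑ n ∈ Finset.range N, frontAverage m (fun s => h (backAverage m b s)) (n + 1)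
        * (b (n + 1) - b n) ≤ (∫ z in (0 : ℝ)..β, h z) + 1 / ((m : ℝ) + 1) := by
  have hint : ∀ x y : ℝ, IntervalIntegrable h MeasureTheory.volume x y :=
    fun x y => hh.intervalIntegrable
  have hnn : ∀ t, 0 ≤ b t := fun t => by
    rcases le_total t 0 with ht | ht
    · exact (hb0 t ht).ge
    · exact (hb0 0 le_rfl).ge.trans (hb ht)
  set v := backAverage m b with hv
  have hstep : ∀ s : ℤ, v s ≤ v (s + 1) ∧ v (s + 1) - v s ≤ 1 / ((m : ℝ) + 1) := by
    intro s
    have h₁ := backAverage_sub (m := m) b s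
    have h₂ : b (s - m) ≤ b (s + 1) := hb (by omega)
    constructor
    · rw [← sub_nonneg, h₁]
      exact mul_nonneg (one_div_succ_nonneg m) (sub_nonneg.2 h₂)
    · rw [h₁]
      refine mul_le_of_le_one_right (one_div_succ_nonneg m) ?_
      linarith [hβ (s + 1), hnn (s - m)]
  -- The sum with left end values lies below the integral. Passing to right end values costs the
  -- mesh times the increment of `h`; both parts telescope.
  have hterm : ∀ s : ℤ, h (v (s + 1)) * (v (s + 1) - v s) ≤
      ((∫ z in (0 : ℝ)..v (s + 1), h z) - ∫ z in (0 : ℝ)..v s, h z)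
        + 1 / ((m : ℝ) + 1) * (h (v (s + 1)) - h (v s)) := by
    intro s
    rw [intervalIntegral.integral_interval_sub_left (hint _ _) (hint _ _)]
    have h₁ : h (v s) * (v (s + 1) - v s) ≤ ∫ z in v s..v (s + 1), h z := by
      have := intervalIntegral.integral_mono_on (hstep s).1
        (intervalIntegrable_const (c := h (v s))) (hint _ _)
        fun x hx => hh hx.1
      rw [intervalIntegral.integral_const, smul_eq_mul] at this
      linarith
    have h₂ := mul_le_mul_of_nonneg_right (hstep s).2 (sub_nonneg.2 (hh (hstep s).1))
    linarith
  refine (sum_frontAverage_mul_le_sum hb (fun s => (h01 _).1) N).trans ?_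
  rw [← hv]
  refine (Finset.sum_le_sum fun (s : ℕ) _ => hterm s).trans ?_
  rw [Finset.sum_add_distrib, ← Finset.mul_sum]
  have t₁ := Finset.sum_range_sub (fun s : ℕ => ∫ z in (0 : ℝ)..v s, h z) (N + m)
  have t₂ := Finset.sum_range_sub (fun s : ℕ => h (v s)) (N + m)
  simp only [Nat.cast_add, Nat.cast_one, Nat.cast_zero] at t₁ t₂
  rw [t₁, t₂]
  have hv0 : v 0 = 0 := by
    rw [hv, backAverage, Finset.sum_eq_zero fun k _ => hb0 _ (by omega), mul_zero]
  have hvβ : v ((N : ℤ) + m) ≤ β := (average_mem_Icc fun k => ⟨hnn _, hβ _⟩).2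
  rw [hv0, intervalIntegral.integral_same, sub_zero]
  have i₁ : ∫ z in (0 : ℝ)..v ((N : ℤ) + m), h z ≤ ∫ z in (0 : ℝ)..β, h z := by
    rw [← sub_nonneg, intervalIntegral.integral_interval_sub_left (hint _ _) (hint _ _)]
    exact intervalIntegral.integral_nonneg hvβ fun x _ => (h01 x).1
  have i₂ : 1 / ((m : ℝ) + 1) * (h (v ((N : ℤ) + m)) - h 0) ≤ 1 / ((m : ℝ) + 1) :=
    mul_le_of_le_one_right (one_div_succ_nonneg m)
      (by linarith [(h01 (v ((N : ℤ) + m))).2, (h01 0).1])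
  linarith

end Average

/-- The profiles on the half-line that the recursion preserves. -/
structure IsProfile (a : ℤ → ℝ) : Prop where
  mono : Monotone a
  zero : ∀ t ≤ 0, a t = 0
  mem : ∀ t, a t ∈ Icc (0 : ℝ) 1

theorem halfLineStep_mono {m : ℕ} {φ : ℝ → ℝ} (hφ : Monotone φ) : Monotone (halfLineStep m φ) := by
  intro b b' h t
  unfold halfLineStep
  split_ifs
  · exact average_mono fun j => hφ (average_mono fun k => h _)
  · exact le_rfl

theorem IsProfile.halfLineStep {m : ℕ} {φ : ℝ → ℝ} (hφ : Monotone φ)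
    (hφ1 : ∀ x, φ x ∈ Icc (0 : ℝ) 1) {b : ℤ → ℝ} (hb : IsProfile b) :
    IsProfile (halfLineStep m φ b) where
  mono := by
    intro t t' h
    simp only [_root_.halfLineStep]
    split_ifs with h₁ h₂ h₂
    · exact average_mono fun j => hφ (average_mono fun k => hb.mono (by omega))
    · omega
    · exact (average_mem_Icc fun j => hφ1 _).1
    · exact le_rfl
  zero t ht := if_neg (by omega)
  mem t := by
    simp only [_root_.halfLineStep]
    split_ifs
    · exact average_mem_Icc fun j => hφ1 _
    · simp

theorem tendsto_halfLineStep {m : ℕ} {φ : ℝ → ℝ} (hφ : Continuous φ) {b : ℕ → ℤ → ℝ} {c : ℤ → ℝ}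
    (h : ∀ t, Tendsto (fun i => b i t) atTop (𝓝 (c t))) (t : ℤ) :
    Tendsto (fun i => halfLineStep m φ (b i) t) atTop (𝓝 (halfLineStep m φ c t)) := by
  unfold halfLineStep
  split_ifs
  · exact tendsto_average fun j => (hφ.tendsto _).comp (tendsto_average fun k => h _)
  · exact tendsto_const_nhds

theorem IsProfile.tendsto_ciSup {a : ℤ → ℝ} (ha : IsProfile a) : Tendsto a atTop (𝓝 (⨆ t, a t)) :=
  tendsto_atTop_ciSup ha.mono ⟨1, by rintro _ ⟨t, rfl⟩; exact (ha.mem t).2⟩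

theorem IsProfile.le_ciSup {a : ℤ → ℝ} (ha : IsProfile a) (t : ℤ) : a t ≤ ⨆ t, a t :=
  _root_.le_ciSup (f := a) ⟨1, by rintro _ ⟨t, rfl⟩; exact (ha.mem t).2⟩ t

theorem IsProfile.ciSup_mem {a : ℤ → ℝ} (ha : IsProfile a) : (⨆ t, a t) ∈ Icc (0 : ℝ) 1 :=
  ⟨(ha.mem 0).1.trans (ha.le_ciSup 0), ciSup_le fun t => (ha.mem t).2⟩

/-- The limit of a fixed point at infinity is related by the uncoupled recursion. -/
theorem IsProfile.ciSup_eq {m : ℕ} {φ : ℝ → ℝ} (hφ : Continuous φ) {a b : ℤ → ℝ}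
    (ha : IsProfile a) (hb : IsProfile b) (hab : a = _root_.halfLineStep m φ b) :
    (⨆ t, a t) = φ (⨆ t, b t) := by
  have h₁ : Tendsto (fun t => frontAverage m (fun s => φ (backAverage m b s)) t) atTop
      (𝓝 (φ (⨆ t, b t))) := by
    have hback : Tendsto (fun t => backAverage m b t) atTop (𝓝 (⨆ t, b t)) := by
      have := tendsto_average (m := m) (l := atTop) (f := fun (t : ℤ) k => b (t - k))
        (c := fun _ => ⨆ t, b t) fun k =>
          hb.tendsto_ciSup.comp (tendsto_atTop_add_const_right atTop (-(k : ℤ)) tendsto_id)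
      rwa [average_const] at this
    have := tendsto_average (m := m) (l := atTop) (f := fun (t : ℤ) j => φ (backAverage m b (t + j)))
      (c := fun _ => φ (⨆ t, b t)) fun j => ((hφ.tendsto _).comp hback).comp
        (tendsto_atTop_add_const_right atTop (j : ℤ) tendsto_id)
    rwa [average_const] at this
  refine tendsto_nhds_unique ha.tendsto_ciSup (h₁.congr' ?_)
  filter_upwards [eventually_ge_atTop 1] with t ht
  rw [hab, _root_.halfLineStep, if_pos ht]

/-- The potential of the limit at infinity of a coupled fixed point on the half-line is small. -/
theorem potential_ciSup_le {m : ℕ} {φ ψ : ℝ → ℝ} (hφ : Monotone φ)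
    (hφ1 : ∀ x, φ x ∈ Icc (0 : ℝ) 1) (hψ : Monotone ψ) (hψ1 : ∀ x, ψ x ∈ Icc (0 : ℝ) 1)
    {a b : ℤ → ℝ} (ha : IsProfile a) (hb : IsProfile b) (hab : a = halfLineStep m φ b)
    (hba : b = halfLineStep m ψ a) :
    (⨆ t, a t) * (⨆ t, b t) - (∫ z in (0 : ℝ)..⨆ t, b t, φ z) - (∫ z in (0 : ℝ)..⨆ t, a t, ψ z)
      ≤ 2 / ((m : ℝ) + 1) := by
  have hN : ∀ N : ℕ, a N * b N ≤ ((∫ z in (0 : ℝ)..⨆ t, b t, φ z) + 1 / ((m : ℝ) + 1))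
      + ((∫ z in (0 : ℝ)..⨆ t, a t, ψ z) + 1 / ((m : ℝ) + 1)) := by
    intro N
    -- Each of the two Riemann sums costs 1/(m+1), whence the bound 2/(m+1).
    have h₁ := sum_frontAverage_mul_le_integral (m := m) hφ hφ1 hb.mono hb.zero hb.le_ciSup
      hb.ciSup_mem.2 N
    have h₂ := sum_frontAverage_mul_le_integral (m := m) hψ hψ1 ha.mono ha.zero ha.le_ciSup
      ha.ciSup_mem.2 N
    refine le_trans ?_ (add_le_add h₁ h₂)
    have t := Finset.sum_range_sub (fun n : ℕ => a n * b n) N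
    simp only [Nat.cast_add, Nat.cast_one, Nat.cast_zero, ha.zero 0 le_rfl, zero_mul,
      sub_zero] at t
    rw [← t, ← Finset.sum_add_distrib]
    refine Finset.sum_le_sum fun n _ => ?_
    have ea : a (n + 1) = frontAverage m (fun s => φ (backAverage m b s)) (n + 1) :=
      (congrFun hab _).trans (if_pos (by omega))
    have eb : b (n + 1) = frontAverage m (fun s => ψ (backAverage m a s)) (n + 1) :=
      (congrFun hba _).trans (if_pos (by omega))
    rw [← ea, ← eb]
    -- In the discrete product rule, a'(b' - b) + b'(a' - a) exceeds a'b' - ab by (a' - a)(b' - b),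
    -- which is nonnegative as both profiles are nondecreasing.
    have := mul_nonneg (sub_nonneg.2 (ha.mono (show (n : ℤ) ≤ n + 1 by omega)))
      (sub_nonneg.2 (hb.mono (show (n : ℤ) ≤ n + 1 by omega)))
    nlinarith [this]
  have hlim := le_of_tendsto' ((ha.tendsto_ciSup.mul hb.tendsto_ciSup).comp
    tendsto_natCast_atTop_atTop) hN
  have : 2 / ((m : ℝ) + 1) = 1 / ((m : ℝ) + 1) + 1 / ((m : ℝ) + 1) := by ring
  linarith

/-- The coupled recursion on the half-line. -/
noncomputable def halfLineMap (m : ℕ) (φ ψ : ℝ → ℝ) (x : (ℤ → ℝ) × (ℤ → ℝ)) :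
    (ℤ → ℝ) × (ℤ → ℝ) := (halfLineStep m φ x.2, halfLineStep m ψ x.1)

/-- The profile with the value `1` at all positions `t ≥ 1`. -/
def unitProfile (t : ℤ) : ℝ := if 1 ≤ t then 1 else 0

theorem isProfile_unitProfile : IsProfile unitProfile where
  mono := by
    intro t t' h
    unfold unitProfile
    split_ifs with h₁ h₂ h₂
    · exact le_rfl
    · omega
    · exact zero_le_one
    · exact le_rfl
  zero t ht := if_neg (by omega)
  mem t := by
    unfold unitProfile
    split_ifs <;> simp

theorem IsProfile.le_unitProfile {a : ℤ → ℝ} (ha : IsProfile a) : a ≤ unitProfile := by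
  intro t
  unfold unitProfile
  split_ifs with h
  · exact (ha.mem t).2
  · exact (ha.zero t (by omega)).le

theorem isProfile_of_tendsto {a : ℕ → ℤ → ℝ} {c : ℤ → ℝ} (ha : ∀ i, IsProfile (a i))
    (h : ∀ t, Tendsto (fun i => a i t) atTop (𝓝 (c t))) : IsProfile c where
  mono t t' htt' := le_of_tendsto_of_tendsto' (h t) (h t') fun i => (ha i).mono htt'
  zero t ht := tendsto_nhds_unique (h t) (by simp [(ha _).zero t ht])
  mem t := isClosed_Icc.mem_of_tendsto (h t) (Eventually.of_forall fun i => (ha i).mem t)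

theorem halfLineMap_iterate_succ (m : ℕ) (φ ψ : ℝ → ℝ) (x : (ℤ → ℝ) × (ℤ → ℝ)) (i : ℕ) :
    (halfLineMap m φ ψ)^[i + 1] x = halfLineMap m φ ψ ((halfLineMap m φ ψ)^[i] x) :=
  Function.iterate_succ_apply' _ _ _

theorem isProfile_halfLineMap_iterate {m : ℕ} {φ ψ : ℝ → ℝ} (hφ : Monotone φ)
    (hφ1 : ∀ x, φ x ∈ Icc (0 : ℝ) 1) (hψ : Monotone ψ) (hψ1 : ∀ x, ψ x ∈ Icc (0 : ℝ) 1) (i : ℕ) :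
    IsProfile ((halfLineMap m φ ψ)^[i] (unitProfile, unitProfile)).1 ∧
      IsProfile ((halfLineMap m φ ψ)^[i] (unitProfile, unitProfile)).2 := by
  induction i with
  | zero => exact ⟨isProfile_unitProfile, isProfile_unitProfile⟩
  | succ i ih =>
    rw [halfLineMap_iterate_succ]
    exact ⟨ih.2.halfLineStep hφ hφ1, ih.1.halfLineStep hψ hψ1⟩

/-- Threshold saturation on the half-line: if the potential of all nonzero fixed points of the
uncoupled recursion is bounded below, then the coupled recursion converges to zero. -/
theorem tendsto_halfLineMap_iterate {m : ℕ} {φ ψ : ℝ → ℝ} (hφ : Monotone φ) (hφc : Continuous φ)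
    (hφ1 : ∀ x, φ x ∈ Icc (0 : ℝ) 1) (hψ : Monotone ψ) (hψc : Continuous ψ)
    (hψ1 : ∀ x, ψ x ∈ Icc (0 : ℝ) 1)
    (hU : ∀ α ∈ Icc (0 : ℝ) 1, ∀ β ∈ Icc (0 : ℝ) 1, α = φ β → β = ψ α → ¬ (α = 0 ∧ β = 0) →
      2 / ((m : ℝ) + 1) < α * β - (∫ z in (0 : ℝ)..β, φ z) - ∫ z in (0 : ℝ)..α, ψ z) (t : ℤ) :
    Tendsto (fun i => ((halfLineMap m φ ψ)^[i] (unitProfile, unitProfile)).1 t) atTop (𝓝 0) ∧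
      Tendsto (fun i => ((halfLineMap m φ ψ)^[i] (unitProfile, unitProfile)).2 t) atTop (𝓝 0) := by
  set X : ℕ → (ℤ → ℝ) × (ℤ → ℝ) := fun i => (halfLineMap m φ ψ)^[i] (unitProfile, unitProfile)
    with hX
  have hsucc : ∀ i, X (i + 1) = halfLineMap m φ ψ (X i) :=
    halfLineMap_iterate_succ m φ ψ _
  have hprof : ∀ i, IsProfile (X i).1 ∧ IsProfile (X i).2 :=
    isProfile_halfLineMap_iterate hφ hφ1 hψ hψ1
  have hmono : Monotone (halfLineMap m φ ψ) := fun x y h =>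
    ⟨halfLineStep_mono hφ h.2, halfLineStep_mono hψ h.1⟩
  -- The start is the largest profile, so the iterates of the monotone map decrease; by continuity
  -- their pointwise limit is a fixed point, and it is again a profile.
  have hanti : Antitone X := hmono.antitone_iterate_of_map_le
    ⟨(hprof 1).1.le_unitProfile, (hprof 1).2.le_unitProfile⟩
  have hlim₁ : ∀ t, Tendsto (fun i => (X i).1 t) atTop (𝓝 (⨅ i, (X i).1 t)) := fun t =>
    tendsto_atTop_ciInf (fun i j h => (hanti h).1 t)
      ⟨0, by rintro _ ⟨i, rfl⟩; exact ((hprof i).1.mem t).1⟩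
  have hlim₂ : ∀ t, Tendsto (fun i => (X i).2 t) atTop (𝓝 (⨅ i, (X i).2 t)) := fun t =>
    tendsto_atTop_ciInf (fun i j h => (hanti h).2 t)
      ⟨0, by rintro _ ⟨i, rfl⟩; exact ((hprof i).2.mem t).1⟩
  set a : ℤ → ℝ := fun t => ⨅ i, (X i).1 t
  set b : ℤ → ℝ := fun t => ⨅ i, (X i).2 t
  have ha : IsProfile a := isProfile_of_tendsto (fun i => (hprof i).1) hlim₁
  have hb : IsProfile b := isProfile_of_tendsto (fun i => (hprof i).2) hlim₂
  have hab : a = halfLineStep m φ b := by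
    funext t
    refine tendsto_nhds_unique ((tendsto_add_atTop_iff_nat 1).2 (hlim₁ t)) ?_
    simp only [hsucc]
    exact tendsto_halfLineStep hφc hlim₂ t
  have hba : b = halfLineStep m ψ a := by
    funext t
    refine tendsto_nhds_unique ((tendsto_add_atTop_iff_nat 1).2 (hlim₂ t)) ?_
    simp only [hsucc]
    exact tendsto_halfLineStep hψc hlim₁ t
  -- The limits at infinity form an uncoupled fixed point with potential at most 2/(m+1), which `hU`
  -- forbids unless it is zero. A profile is bounded by its limit and then vanishes.
  have hzero : (⨆ t, a t) = 0 ∧ (⨆ t, b t) = 0 := by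
    by_contra h0
    exact absurd (potential_ciSup_le hφ hφ1 hψ hψ1 ha hb hab hba)
      (not_le.2 (hU _ ha.ciSup_mem _ hb.ciSup_mem (ha.ciSup_eq hφc hb hab)
        (hb.ciSup_eq hψc ha hba) h0))
  have ha0 : a t = 0 := le_antisymm (hzero.1 ▸ ha.le_ciSup t) (ha.mem t).1
  have hb0 : b t = 0 := le_antisymm (hzero.2 ▸ hb.le_ciSup t) (hb.mem t).1
  exact ⟨ha0 ▸ hlim₁ t, hb0 ▸ hlim₂ t⟩

/-! ### The punctured parallel concatenated code as a vector admissible system -/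

theorem puncturedErasure_mem_Icc {ρ ε : ℝ} (hρ : ρ ∈ Icc (0 : ℝ) 1) (hε : ε ∈ Icc (0 : ℝ) 1) :
    puncturedErasure ρ ε ∈ Icc (0 : ℝ) 1 := by
  unfold puncturedErasure
  have h₁ : 0 ≤ (1 - ε) * ρ := mul_nonneg (sub_nonneg.2 hε.2) hρ.1
  have h₂ : (1 - ε) * ρ ≤ 1 := mul_le_one₀ (by linarith [hε.1]) hρ.1 hρ.2
  exact ⟨by linarith, by linarith⟩

theorem puncturedErasure_mono {ρ ε ε' : ℝ} (hρ : 0 ≤ ρ) (h : ε ≤ ε') :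
    puncturedErasure ρ ε ≤ puncturedErasure ρ ε' := by
  unfold puncturedErasure
  have := mul_le_mul_of_nonneg_right (sub_le_sub_left h 1) hρ
  linarith

theorem puncturedErasure_lt_one {ρ ε : ℝ} (hρ : 0 < ρ) (hε : ε < 1) :
    puncturedErasure ρ ε < 1 := by
  unfold puncturedErasure
  have := mul_pos (sub_pos.2 hε) hρ
  linarith

theorem puncturedErasure_pos {ρ ε : ℝ} (hρ : ρ ∈ Icc (0 : ℝ) 1) (hε : ε ∈ Ioo (0 : ℝ) 1) :
    0 < puncturedErasure ρ ε := by
  unfold puncturedErasure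
  have := mul_le_of_le_one_right (sub_nonneg.2 hε.2.le) hρ.2
  linarith [hε.1]

theorem contDiff_puncturedErasure {n : WithTop ℕ∞} (ρ : ℝ) :
    ContDiff ℝ n (puncturedErasure ρ) := by
  unfold puncturedErasure
  fun_prop

theorem mul_mem_Icc_zero_one {a b : ℝ} (ha : a ∈ Icc (0 : ℝ) 1) (hb : b ∈ Icc (0 : ℝ) 1) :
    a * b ∈ Icc (0 : ℝ) 1 :=
  ⟨mul_nonneg ha.1 hb.1, mul_le_one₀ ha.2 hb.1 hb.2⟩

/-- The parameters for which the density evolution recursion is smooth. -/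
theorem parameter_mem {ρ₀ ε : ℝ} (hε : ε ∈ if 0 < ρ₀ then Ico (0 : ℝ) 1 else Ioo (0 : ℝ) 1) :
    ε ∈ Ico (0 : ℝ) 1 ∧ (0 < ρ₀ ∨ 0 < ε) := by
  split_ifs at hε with h
  · exact ⟨hε, Or.inl h⟩
  · exact ⟨⟨hε.1.le, hε.2⟩, Or.inr hε.1⟩

/-- The erasure probabilities at the input of a component decoder lie in the region where its
transfer function is smooth. -/
theorem scaled_reset {ρ₀ ρ ε z : ℝ} (hρ₀ : ρ₀ ∈ Icc (0 : ℝ) 1) (hρ : ρ ∈ Ioc (0 : ℝ) 1)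
    (hε : ε ∈ Ico (0 : ℝ) 1) (hz : z ∈ Icc (0 : ℝ) 1) (h : 0 < ρ₀ ∨ 0 < ε ∨ z < 1) :
    puncturedErasure ρ₀ ε * z < 1 ∧ puncturedErasure ρ ε < 1 ∨
      0 < puncturedErasure ρ₀ ε * z ∧ 0 < puncturedErasure ρ ε := by
  have h0 := puncturedErasure_mem_Icc hρ₀ ⟨hε.1, hε.2.le⟩
  have hlt := puncturedErasure_lt_one hρ.1 hε.2
  rcases hz.2.lt_or_eq with hz1 | rfl
  · exact Or.inl ⟨lt_of_le_of_lt (mul_le_of_le_one_left hz.1 h0.2) hz1, hlt⟩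
  · rw [mul_one]
    rcases h with h | h | h
    · exact Or.inl ⟨puncturedErasure_lt_one h hε.2, hlt⟩
    -- For z = 1 and ρ₀ = 0 the systematic bit is surely erased, so only total erasure can reset;
    -- this needs ε > 0.
    · exact Or.inr ⟨puncturedErasure_pos hρ₀ ⟨h, hε.2⟩,
        puncturedErasure_pos ⟨hρ.1.le, hρ.2⟩ ⟨h, hε.2⟩⟩
    · exact absurd h (lt_irrefl 1)

/-! ### The component functions of the density evolution map -/

section Component

variable (C : RSCEncoder) {ρ₀ ρ ε : ℝ}

theorem contDiffWithinAt_component {n : WithTop ℕ∞} {E : Type*} [NormedAddCommGroup E]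
    [NormedSpace ℝ E] {a b : E → ℝ} {s : Set E} {x : E} (hx : x ∈ s)
    (ha : ContDiffWithinAt ℝ n a s x) (hb : ContDiffWithinAt ℝ n b s x)
    (has : ∀ y ∈ s, a y ∈ Icc (0 : ℝ) 1) (hbs : ∀ y ∈ s, b y ∈ Ico (0 : ℝ) 1)
    (hρ₀ : ρ₀ ∈ Icc (0 : ℝ) 1) (hρ : ρ ∈ Ioc (0 : ℝ) 1) (h : 0 < ρ₀ ∨ 0 < b x ∨ a x < 1) :
    ContDiffWithinAt ℝ n (fun y => C.sysTransfer (puncturedErasure ρ₀ (b y) * a y)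
      (puncturedErasure ρ (b y))) s x := by
  refine C.contDiffWithinAt_sysTransfer hx
    (((contDiff_puncturedErasure ρ₀).comp_contDiffWithinAt hb).mul ha)
    ((contDiff_puncturedErasure ρ).comp_contDiffWithinAt hb) (fun y hy => ?_)
    (scaled_reset hρ₀ hρ (hbs x hx) (has x hx) h)
  have hy' : b y ∈ Icc (0 : ℝ) 1 := Ico_subset_Icc_self (hbs y hy)
  exact ⟨mul_mem_Icc_zero_one (puncturedErasure_mem_Icc hρ₀ hy') (has y hy),
    puncturedErasure_mem_Icc ⟨hρ.1.le, hρ.2⟩ hy'⟩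

theorem component_mem_Icc (hρ₀ : ρ₀ ∈ Icc (0 : ℝ) 1) (hρ : ρ ∈ Ioc (0 : ℝ) 1)
    (hε : ε ∈ Ico (0 : ℝ) 1) {z : ℝ} (hz : z ∈ Icc (0 : ℝ) 1) :
    C.sysTransfer (puncturedErasure ρ₀ ε * z) (puncturedErasure ρ ε) ∈ Icc (0 : ℝ) 1 :=
  C.sysTransfer_mem_Icc
    (mul_mem_Icc_zero_one (puncturedErasure_mem_Icc hρ₀ (Ico_subset_Icc_self hε)) hz)
    (puncturedErasure_mem_Icc ⟨hρ.1.le, hρ.2⟩ (Ico_subset_Icc_self hε))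

theorem component_mono (hρ₀ : ρ₀ ∈ Icc (0 : ℝ) 1) (hρ : ρ ∈ Ioc (0 : ℝ) 1)
    {ε' : ℝ} (hε : ε ∈ Ico (0 : ℝ) 1) (hε' : ε' ∈ Ico (0 : ℝ) 1) (hεε' : ε ≤ ε') {z z' : ℝ}
    (hz : z ∈ Icc (0 : ℝ) 1) (hz' : z' ∈ Icc (0 : ℝ) 1) (hzz' : z ≤ z') :
    C.sysTransfer (puncturedErasure ρ₀ ε * z) (puncturedErasure ρ ε)
      ≤ C.sysTransfer (puncturedErasure ρ₀ ε' * z') (puncturedErasure ρ ε') := by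
  have h₀ := puncturedErasure_mem_Icc hρ₀ (Ico_subset_Icc_self hε)
  have h₀' := puncturedErasure_mem_Icc hρ₀ (Ico_subset_Icc_self hε')
  exact C.sysTransfer_mono (mul_mem_Icc_zero_one h₀ hz)
    (puncturedErasure_mem_Icc ⟨hρ.1.le, hρ.2⟩ (Ico_subset_Icc_self hε))
    (mul_mem_Icc_zero_one h₀' hz')
    (puncturedErasure_mem_Icc ⟨hρ.1.le, hρ.2⟩ (Ico_subset_Icc_self hε'))
    (mul_le_mul (puncturedErasure_mono hρ₀.1 hεε') hzz' hz.1 h₀'.1)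
    (puncturedErasure_mono hρ.1.le hεε')

theorem component_zero : C.sysTransfer (puncturedErasure ρ₀ ε * 0) (puncturedErasure ρ ε) = 0 := by
  rw [mul_zero, C.sysTransfer_zero_left]

theorem component_monotoneOn (hρ₀ : ρ₀ ∈ Icc (0 : ℝ) 1) (hρ : ρ ∈ Ioc (0 : ℝ) 1)
    (hε : ε ∈ Ico (0 : ℝ) 1) :
    MonotoneOn (fun z => C.sysTransfer (puncturedErasure ρ₀ ε * z) (puncturedErasure ρ ε))
      (Icc 0 1) := fun _ hz _ hz' h => component_mono C hρ₀ hρ hε hε le_rfl hz hz' h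

theorem component_continuousWithinAt (hρ₀ : ρ₀ ∈ Icc (0 : ℝ) 1) (hρ : ρ ∈ Ioc (0 : ℝ) 1)
    (hε : ε ∈ Ico (0 : ℝ) 1) {z : ℝ} (hz : z ∈ Icc (0 : ℝ) 1) (h : 0 < ρ₀ ∨ 0 < ε ∨ z < 1) :
    ContinuousWithinAt
      (fun z => C.sysTransfer (puncturedErasure ρ₀ ε * z) (puncturedErasure ρ ε)) (Icc 0 1) z :=
  (contDiffWithinAt_component (n := 1) C (a := fun z => z) (b := fun _ => ε) hz
    contDiffWithinAt_id contDiffWithinAt_const (fun _ hy => hy) (fun _ _ => hε)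
    hρ₀ hρ h).continuousWithinAt

theorem component_continuousOn (hρ₀ : ρ₀ ∈ Icc (0 : ℝ) 1) (hρ : ρ ∈ Ioc (0 : ℝ) 1)
    (hε : ε ∈ Ico (0 : ℝ) 1) (h : 0 < ρ₀ ∨ 0 < ε) :
    ContinuousOn
      (fun z => C.sysTransfer (puncturedErasure ρ₀ ε * z) (puncturedErasure ρ ε)) (Icc 0 1) :=
  fun _ hz => component_continuousWithinAt C hρ₀ hρ hε hz (h.imp_right Or.inl)

end Component

theorem rowForm_apply {d : ℕ} (a v : Fin d → ℝ) : rowForm a v = ∑ i, a i * v i := by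
  simp [rowForm]

theorem hasFDerivWithinAt_integral_comp {φ : ℝ → ℝ} (hφ : ContinuousOn φ (Icc 0 1)) (i : Fin 2)
    {x : Fin 2 → ℝ} (hx : x ∈ unitCube 2) :
    HasFDerivWithinAt (fun y : Fin 2 → ℝ => ∫ z in (0 : ℝ)..y i, φ z)
      (φ (x i) • ContinuousLinearMap.proj (R := ℝ) (φ := fun _ : Fin 2 => ℝ) i)
      (unitCube 2) x := by
  have hxi := mem_unitCube.1 hx i
  -- Extending `φ` by its end values makes the fundamental theorem available as a two-sided
  -- derivative, also at the end points.
  have hcont : Continuous (IccExtend zero_le_one ((Icc (0 : ℝ) 1).domRestrict φ)) :=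
    continuous_IccExtend_iff.2 (continuousOn_iff_continuous_domRestrict.1 hφ)
  have heq : ∀ z ∈ Icc (0 : ℝ) 1, IccExtend zero_le_one ((Icc (0 : ℝ) 1).domRestrict φ) z = φ z :=
    fun z hz => IccExtend_of_mem _ _ hz
  have hd : HasDerivAt (fun u => ∫ z in (0 : ℝ)..u,
      IccExtend zero_le_one ((Icc (0 : ℝ) 1).domRestrict φ) z) (φ (x i)) (x i) := by
    rw [← heq _ hxi]
    exact hcont.integral_hasStrictDerivAt 0 (x i) |>.hasDerivAt
  have h := hd.comp_hasFDerivWithinAt (s := unitCube 2) x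
    ((ContinuousLinearMap.proj (R := ℝ) (φ := fun _ : Fin 2 => ℝ) i).hasFDerivWithinAt)
  have hint : ∀ y ∈ unitCube 2, ∫ z in (0 : ℝ)..y i, φ z = ∫ z in (0 : ℝ)..y i,
      IccExtend zero_le_one ((Icc (0 : ℝ) 1).domRestrict φ) z := by
    intro y hy
    have hyi := mem_unitCube.1 hy i
    refine intervalIntegral.integral_congr fun z hz => (heq z ?_).symm
    rw [uIcc_of_le hyi.1] at hz
    exact ⟨hz.1, hz.2.trans hyi.2⟩
  exact h.congr hint (hint x hx)

theorem isVectorAdmissible_pcc (CU CL : RSCEncoder) {ρ₀ ρ₁ ρ₂ : ℝ}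
    (hρ₀ : ρ₀ ∈ Icc (0 : ℝ) 1) (hρ₁ : ρ₁ ∈ Ioc (0 : ℝ) 1) (hρ₂ : ρ₂ ∈ Ioc (0 : ℝ) 1) :
    IsVectorAdmissible (if 0 < ρ₀ then Ico (0 : ℝ) 1 else Ioo (0 : ℝ) 1)
      (pccF CU CL ρ₀ ρ₁ ρ₂) pccG 1 (pccFInt CU CL ρ₀ ρ₁ ρ₂) pccGInt where
  diag := isDiag_one
  diag_pos i := by simp
  f_mapsTo x hx ε hε := by
    rw [mem_unitCube] at hx
    have hε' := (parameter_mem hε).1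
    exact RSCEncoder.vec_mem_unitCube (component_mem_Icc CU hρ₀ hρ₁ hε' (hx 0))
      (component_mem_Icc CL hρ₀ hρ₂ hε' (hx 1))
  g_mapsTo x hx := by
    rw [mem_unitCube] at hx
    exact RSCEncoder.vec_mem_unitCube (hx 1) (hx 0)
  f_contDiff := by
    intro z hz
    have hfst : ∀ i : Fin 2, ContDiffWithinAt ℝ 2 (fun z : (Fin 2 → ℝ) × ℝ => z.1 i)
        (unitCube 2 ×ˢ if 0 < ρ₀ then Ico (0 : ℝ) 1 else Ioo (0 : ℝ) 1) z := fun i =>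
      ((contDiff_apply ℝ ℝ i).comp contDiff_fst).contDiffWithinAt
    have h := (parameter_mem hz.2).2.imp_right (Or.inl (b := z.1 0 < 1))
    have h' := (parameter_mem hz.2).2.imp_right (Or.inl (b := z.1 1 < 1))
    rw [contDiffWithinAt_pi]
    intro i
    fin_cases i
    · exact contDiffWithinAt_component CU hz (hfst 0) contDiffWithinAt_snd
        (fun y hy => mem_unitCube.1 hy.1 0) (fun y hy => (parameter_mem hy.2).1) hρ₀ hρ₁ h
    · exact contDiffWithinAt_component CL hz (hfst 1) contDiffWithinAt_snd
        (fun y hy => mem_unitCube.1 hy.1 1) (fun y hy => (parameter_mem hy.2).1) hρ₀ hρ₂ h'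
  g_contDiff := by
    refine ContDiff.contDiffOn (contDiff_pi.2 fun i => ?_)
    fin_cases i
    · exact contDiff_apply ℝ ℝ 1
    · exact contDiff_apply ℝ ℝ 0
  f_mono x hx y hy ε hε ε' hε' hxy hεε' := by
    rw [mem_unitCube] at hx hy
    intro i
    fin_cases i
    · exact component_mono CU hρ₀ hρ₁ (parameter_mem hε).1 (parameter_mem hε').1 hεε' (hx 0) (hy 0)
        (hxy 0)
    · exact component_mono CL hρ₀ hρ₂ (parameter_mem hε).1 (parameter_mem hε').1 hεε' (hx 1) (hy 1)
        (hxy 1)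
  g_mono x _ y _ hxy i := by
    fin_cases i
    · exact hxy 1
    · exact hxy 0
  F_deriv ε hε x hx := by
    have hε' := parameter_mem hε
    have h := (hasFDerivWithinAt_integral_comp
      (component_continuousOn CU hρ₀ hρ₁ hε'.1 hε'.2) 0 hx).add
      (hasFDerivWithinAt_integral_comp (component_continuousOn CL hρ₀ hρ₂ hε'.1 hε'.2) 1 hx)
    refine h.congr_fderiv (ContinuousLinearMap.ext fun v => ?_)
    rw [rowForm_apply, vecMul_one, Fin.sum_univ_two]
    rfl
  G_deriv x _ := by
    have h := (hasFDerivAt_apply (𝕜 := ℝ) (F' := fun _ : Fin 2 => ℝ) 0 x).mul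
      (hasFDerivAt_apply (𝕜 := ℝ) (F' := fun _ : Fin 2 => ℝ) 1 x)
    refine h.hasFDerivWithinAt.congr_fderiv (ContinuousLinearMap.ext fun v => ?_)
    rw [rowForm_apply, vecMul_one, Fin.sum_univ_two]
    simp [pccG]
    ring
  f_zero ε _ := by
    funext i
    fin_cases i
    · exact component_zero CU
    · exact component_zero CL
  F_zero ε _ := by simp [pccFInt, pccG]
  G_zero := by simp [pccGInt]

/-! ### The potential as a line integral -/

/-- A change of variables for the integral of a monotone function on the unit interval that may
fail to be continuous at the right end point. -/
theorem integral_comp_mul_derivWithin {φ : ℝ → ℝ} (hφ : MonotoneOn φ (Icc 0 1))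
    (hφc : ContinuousOn φ (Ico 0 1)) {γ : ℝ → ℝ} (hγ : ContDiffOn ℝ 1 γ (Icc 0 1))
    (hγ1 : ∀ t ∈ Icc (0 : ℝ) 1, γ t ∈ Icc (0 : ℝ) 1) (hγ0 : γ 0 = 0) :
    IntervalIntegrable (fun t => φ (γ t) * derivWithin γ (Icc 0 1) t) MeasureTheory.volume 0 1 ∧
      ∫ t in (0 : ℝ)..1, φ (γ t) * derivWithin γ (Icc 0 1) t = ∫ z in (0 : ℝ)..γ 1, φ z := by
  -- A monotone function has a left limit at 1; taking it as the new value there makes the function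
  -- continuous on the closed interval.
  obtain ⟨ψ, hψc, hψ⟩ : ∃ ψ : ℝ → ℝ, ContinuousOn ψ (Icc 0 1) ∧ ∀ z, z ≠ 1 → ψ z = φ z := by
    have hbdd : BddAbove (φ '' Ioo 0 1) := by
      refine ⟨φ 1, ?_⟩
      rintro _ ⟨z, hz, rfl⟩
      exact hφ (Ioo_subset_Icc_self hz) (right_mem_Icc.2 zero_le_one) hz.2.le
    have hlim := (hφ.mono Ioo_subset_Icc_self).tendsto_nhdsWithin_Ioo_left
      (nonempty_Ioo.2 zero_lt_one) hbdd
    refine ⟨Function.update φ 1 (sSup (φ '' Ioo 0 1)), ?_, fun z hz => Function.update_of_ne hz _ _⟩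
    rw [continuousOn_update_iff]
    have hsub : ∀ z ∈ Icc (0 : ℝ) 1 \ {1}, z ∈ Ico (0 : ℝ) 1 := fun z hz =>
      ⟨hz.1.1, lt_of_le_of_ne hz.1.2 hz.2⟩
    exact ⟨hφc.mono hsub, fun _ => hlim.mono_left (nhdsWithin_mono _ fun z hz => (hsub z hz).2)⟩
  have hdc : ContinuousOn (derivWithin γ (Icc 0 1)) (Icc 0 1) :=
    hγ.continuousOn_derivWithin (uniqueDiffOn_Icc zero_lt_one) le_rfl
  have hda : ∀ t ∈ Ioo (0 : ℝ) 1, HasDerivAt γ (derivWithin γ (Icc 0 1) t) t := fun t ht =>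
    ((hγ.differentiableOn one_ne_zero t (Ioo_subset_Icc_self ht)).hasDerivWithinAt).hasDerivAt
      (Icc_mem_nhds ht.1 ht.2)
  have hmaps : MapsTo γ (Icc 0 1) (Icc 0 1) := hγ1
  have heq : ∀ t ∈ Ioo (0 : ℝ) 1, ψ (γ t) * derivWithin γ (Icc 0 1) t
      = φ (γ t) * derivWithin γ (Icc 0 1) t := by
    intro t ht
    by_cases h1 : γ t = 1
    -- At an interior time with `γ t = 1` the path attains its maximum, so its derivative vanishes
    -- and the changed value of `φ` at 1 does not matter.
    · have hmax : IsLocalMax γ t := by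
        filter_upwards [Icc_mem_nhds ht.1 ht.2] with s hs
        rw [h1]
        exact (hγ1 s hs).2
      rw [hmax.hasDerivAt_eq_zero (hda t ht), mul_zero, mul_zero]
    · rw [hψ _ h1]
  have hcont : ContinuousOn (fun t => ψ (γ t) * derivWithin γ (Icc 0 1) t) (Icc 0 1) :=
    (hψc.comp hγ.continuousOn hmaps).mul hdc
  have hae : ∀ᵐ t ∂MeasureTheory.volume, t ∈ uIoc (0 : ℝ) 1 → ψ (γ t) * derivWithin γ (Icc 0 1) t
      = φ (γ t) * derivWithin γ (Icc 0 1) t := by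
    have h1 : ∀ᵐ t : ℝ ∂MeasureTheory.volume, t ≠ 1 := by
      simp [MeasureTheory.ae_iff]
    filter_upwards [h1] with t ht hmem
    rw [uIoc_of_le zero_le_one] at hmem
    exact heq t ⟨hmem.1, lt_of_le_of_ne hmem.2 ht⟩
  constructor
  · exact (hcont.intervalIntegrable_of_Icc zero_le_one).congr_ae
      ((MeasureTheory.ae_restrict_iff' measurableSet_uIoc).2 hae)
  · rw [← intervalIntegral.integral_congr_ae hae]
    have hsub := intervalIntegral.integral_comp_mul_deriv'' (a := 0) (b := 1) (f := γ)
      (f' := derivWithin γ (Icc 0 1)) (g := ψ) (by rw [uIcc_of_le zero_le_one]; exact hγ.continuousOn)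
      (by
        intro t ht
        rw [min_eq_left zero_le_one, max_eq_right zero_le_one] at ht
        exact (hda t ht).hasDerivWithinAt)
      (by rw [uIcc_of_le zero_le_one]; exact hdc)
      (by rw [uIcc_of_le zero_le_one]; exact hψc.mono hmaps.image_subset)
    rw [hγ0] at hsub
    refine hsub.trans (intervalIntegral.integral_congr_ae ?_)
    have h1 : ∀ᵐ z : ℝ ∂MeasureTheory.volume, z ≠ 1 := by
      simp [MeasureTheory.ae_iff]
    filter_upwards [h1] with z hz _ using hψ z hz

theorem unitCube_uniqueDiffOn (d : ℕ) : UniqueDiffOn ℝ (unitCube d) := by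
  have h : unitCube d = Set.pi Set.univ fun _ : Fin d => Icc (0 : ℝ) 1 := by
    ext x
    simp only [mem_unitCube, Set.mem_univ_pi]
  rw [h]
  exact UniqueDiffOn.univ_pi fun _ => uniqueDiffOn_Icc zero_lt_one

theorem fderivWithin_pccG {x : Fin 2 → ℝ} (hx : x ∈ unitCube 2) (v : Fin 2 → ℝ) :
    fderivWithin ℝ pccG (unitCube 2) x v = ![v 1, v 0] := by
  let A : (Fin 2 → ℝ) →L[ℝ] (Fin 2 → ℝ) := ContinuousLinearMap.pi
    ![ContinuousLinearMap.proj (R := ℝ) (φ := fun _ : Fin 2 => ℝ) 1,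
      ContinuousLinearMap.proj (R := ℝ) (φ := fun _ : Fin 2 => ℝ) 0]
  have hA : ∀ v, A v = pccG v := by
    intro v
    funext i
    fin_cases i <;> rfl
  have h : HasFDerivWithinAt pccG A (unitCube 2) x :=
    A.hasFDerivWithinAt.congr (fun y _ => (hA y).symm) (hA x).symm
  rw [h.fderivWithin (unitCube_uniqueDiffOn 2 x hx), hA]
  rfl

/-- In coordinates the form is d(x₀x₁) - f_U(x₁) dx₁ - f_L(x₀) dx₀, a sum of exact forms. The change
of variables avoids continuity at 1, which is not available at ε = 0 with ρ₀ = 0. -/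
theorem integral_potentialIntegrand_pcc (CU CL : RSCEncoder) {ρ₀ ρ₁ ρ₂ ε : ℝ}
    (hρ₀ : ρ₀ ∈ Icc (0 : ℝ) 1) (hρ₁ : ρ₁ ∈ Ioc (0 : ℝ) 1) (hρ₂ : ρ₂ ∈ Ioc (0 : ℝ) 1)
    (hε : ε ∈ Ico (0 : ℝ) 1) {γ : ℝ → (Fin 2 → ℝ)} (hγ : ContDiffOn ℝ 1 γ (Icc 0 1))
    (hγ1 : ∀ t ∈ Icc (0 : ℝ) 1, γ t ∈ unitCube 2) (hγ0 : γ 0 = 0) :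
    IntervalIntegrable (potentialIntegrand (pccF CU CL ρ₀ ρ₁ ρ₂) pccG 1 ε γ)
        MeasureTheory.volume 0 1 ∧
      ∫ t in (0 : ℝ)..1, potentialIntegrand (pccF CU CL ρ₀ ρ₁ ρ₂) pccG 1 ε γ t =
        potential pccG 1 (pccFInt CU CL ρ₀ ρ₁ ρ₂) pccGInt (γ 1) ε := by
  have hγi : ∀ i, ContDiffOn ℝ 1 (fun t => γ t i) (Icc 0 1) := fun i => contDiffOn_pi.1 hγ i
  have hcont : ∀ C : RSCEncoder, ∀ ρ ∈ Ioc (0 : ℝ) 1, ContinuousOn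
      (fun z => C.sysTransfer (puncturedErasure ρ₀ ε * z) (puncturedErasure ρ ε)) (Ico 0 1) :=
    fun C ρ hρ z hz => (component_continuousWithinAt C hρ₀ hρ hε (Ico_subset_Icc_self hz)
      (Or.inr (Or.inr hz.2))).mono Ico_subset_Icc_self
  obtain ⟨iU, eU⟩ := integral_comp_mul_derivWithin (component_monotoneOn CU hρ₀ hρ₁ hε)
    (hcont CU ρ₁ hρ₁) (hγi 1) (fun t ht => mem_unitCube.1 (hγ1 t ht) 1) (congrFun hγ0 1)
  obtain ⟨iL, eL⟩ := integral_comp_mul_derivWithin (component_monotoneOn CL hρ₀ hρ₂ hε)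
    (hcont CL ρ₂ hρ₂) (hγi 0) (fun t ht => mem_unitCube.1 (hγ1 t ht) 0) (congrFun hγ0 0)
  have hdi : ∀ i, ∀ t ∈ uIcc (0 : ℝ) 1, HasDerivWithinAt (fun t => γ t i)
      (derivWithin (fun t => γ t i) (Icc 0 1) t) (uIcc (0 : ℝ) 1) t := by
    intro i t ht
    rw [uIcc_of_le zero_le_one] at ht ⊢
    exact ((hγi i).differentiableOn one_ne_zero t ht).hasDerivWithinAt
  have hdc : ∀ i, ContinuousOn (derivWithin (fun t => γ t i) (Icc 0 1)) (uIcc 0 1) := by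
    intro i
    rw [uIcc_of_le zero_le_one]
    exact (hγi i).continuousOn_derivWithin (uniqueDiffOn_Icc zero_lt_one) le_rfl
  have hprod := intervalIntegral.integral_deriv_mul_eq_sub_of_hasDerivWithinAt (hdi 0) (hdi 1)
    (hdc 0).intervalIntegrable (hdc 1).intervalIntegrable
  have hprodc : IntervalIntegrable (fun t => derivWithin (fun t => γ t 0) (Icc 0 1) t * γ t 1
      + γ t 0 * derivWithin (fun t => γ t 1) (Icc 0 1) t) MeasureTheory.volume 0 1 := by
    have hc : ∀ i, ContinuousOn (fun t => γ t i) (uIcc 0 1) := fun i t ht =>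
      (hdi i t ht).continuousWithinAt
    exact (((hdc 0).mul (hc 1)).add ((hc 0).mul (hdc 1))).intervalIntegrable
  have heq : ∀ t ∈ uIcc (0 : ℝ) 1,
      (derivWithin (fun t => γ t 0) (Icc 0 1) t * γ t 1
        + γ t 0 * derivWithin (fun t => γ t 1) (Icc 0 1) t)
      - CU.sysTransfer (puncturedErasure ρ₀ ε * γ t 1) (puncturedErasure ρ₁ ε)
        * derivWithin (fun t => γ t 1) (Icc 0 1) t
      - CL.sysTransfer (puncturedErasure ρ₀ ε * γ t 0) (puncturedErasure ρ₂ ε)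
        * derivWithin (fun t => γ t 0) (Icc 0 1) t
      = potentialIntegrand (pccF CU CL ρ₀ ρ₁ ρ₂) pccG 1 ε γ t := by
    intro t ht
    rw [uIcc_of_le zero_le_one] at ht
    rw [potentialIntegrand, fderivWithin_pccG (hγ1 t ht), vecMul_one, derivWithin_pi
      fun i => (hγi i).differentiableOn one_ne_zero t ht]
    simp [dotProduct, pccF, pccMap, pccG]
    ring
  have hint := (hprodc.sub iU).sub iL
  refine ⟨hint.congr fun t ht => heq t (uIoc_subset_uIcc ht), ?_⟩
  rw [← intervalIntegral.integral_congr heq, intervalIntegral.integral_sub (hprodc.sub iU) iL,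
    intervalIntegral.integral_sub hprodc iU, hprod, eU, eL, hγ0]
  simp [potential, pccGInt, pccFInt, pccG, dotProduct]
  ring

/-! ### The spatially coupled code -/

theorem scAverage_scPccDE (CU CL : RSCEncoder) (ρ₀ ρ₁ ρ₂ : ℝ) (m L : ℕ) (ε : ℝ)
    (p : ℤ → (Fin 2 → ℝ)) :
    scAverage m L (scPccDE CU CL ρ₀ ρ₁ ρ₂ m L ε p) =
      coupledStep m L (scPccMap CU CL ρ₀ ρ₁ ρ₂ L ε) pccG (scAverage m L p) := by
  funext t c
  simp only [coupledStep]
  rw [scAverage]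
  split_ifs with ht
  · rw [Pi.smul_apply, Finset.sum_apply, smul_eq_mul]
    congr 1
    refine Finset.sum_congr rfl fun j _ => ?_
    simp only [scPccDE, scPccMap, scParityErasure]
    split_ifs with hj <;> fin_cases c <;>
      simp [pccF, pccMap, pccG, scInput, Finset.sum_apply]
  · rfl

/-- The transfer function of a punctured component code, extended from the unit interval to the
line by its values at the end points. -/
noncomputable def clampedComponent (C : RSCEncoder) (ρ₀ ρ ε z : ℝ) : ℝ :=
  C.sysTransfer (puncturedErasure ρ₀ ε * (projIcc (0 : ℝ) 1 zero_le_one z : ℝ))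
    (puncturedErasure ρ ε)

section Clamped

variable (C : RSCEncoder) {ρ₀ ρ ε : ℝ}

theorem clampedComponent_of_mem {z : ℝ} (hz : z ∈ Icc (0 : ℝ) 1) :
    clampedComponent C ρ₀ ρ ε z =
      C.sysTransfer (puncturedErasure ρ₀ ε * z) (puncturedErasure ρ ε) := by
  rw [clampedComponent, projIcc_of_mem _ hz]

theorem clampedComponent_monotone (hρ₀ : ρ₀ ∈ Icc (0 : ℝ) 1) (hρ : ρ ∈ Ioc (0 : ℝ) 1)
    (hε : ε ∈ Ico (0 : ℝ) 1) : Monotone (clampedComponent C ρ₀ ρ ε) := fun _ _ h =>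
  component_monotoneOn C hρ₀ hρ hε (Subtype.coe_prop _) (Subtype.coe_prop _)
    (monotone_projIcc _ h)

theorem clampedComponent_mem_Icc (hρ₀ : ρ₀ ∈ Icc (0 : ℝ) 1) (hρ : ρ ∈ Ioc (0 : ℝ) 1)
    (hε : ε ∈ Ico (0 : ℝ) 1) (z : ℝ) : clampedComponent C ρ₀ ρ ε z ∈ Icc (0 : ℝ) 1 :=
  component_mem_Icc C hρ₀ hρ hε (Subtype.coe_prop _)

theorem clampedComponent_continuous (hρ₀ : ρ₀ ∈ Icc (0 : ℝ) 1) (hρ : ρ ∈ Ioc (0 : ℝ) 1)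
    (hε : ε ∈ Ioo (0 : ℝ) 1) : Continuous (clampedComponent C ρ₀ ρ ε) :=
  (component_continuousOn C hρ₀ hρ (Ioo_subset_Ico_self hε) (Or.inr hε.1)).comp_continuous
    (continuous_subtype_val.comp continuous_projIcc) fun _ => Subtype.coe_prop _

theorem clampedComponent_zero : clampedComponent C ρ₀ ρ ε 0 = 0 := by
  rw [clampedComponent_of_mem C (left_mem_Icc.2 zero_le_one), component_zero]

theorem integral_clampedComponent {β : ℝ} (hβ : β ∈ Icc (0 : ℝ) 1) :
    ∫ z in (0 : ℝ)..β, clampedComponent C ρ₀ ρ ε z =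
      ∫ z in (0 : ℝ)..β, C.sysTransfer (puncturedErasure ρ₀ ε * z) (puncturedErasure ρ ε) := by
  refine intervalIntegral.integral_congr fun z hz => ?_
  rw [uIcc_of_le hβ.1] at hz
  exact clampedComponent_of_mem C ⟨hz.1, hz.2.trans hβ.2⟩

theorem scParityErasure_mem_Icc {L : ℕ} {e : ℝ} (he : 0 ≤ e) (t : ℤ) :
    scParityErasure L e t ∈ Icc 0 e := by
  unfold scParityErasure
  split_ifs
  · exact ⟨he, le_rfl⟩
  · exact ⟨le_rfl, he⟩

/-- One component of the density evolution recursion is dominated by that for a larger channel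
parameter and a larger input profile. -/
theorem sysTransfer_backAverage_mem_Icc (hρ₀ : ρ₀ ∈ Icc (0 : ℝ) 1) (hρ : ρ ∈ Ioc (0 : ℝ) 1)
    {ε' : ℝ} (hε : ε ∈ Ico (0 : ℝ) 1) (hε' : ε' ∈ Ico (0 : ℝ) 1) (hεε' : ε ≤ ε') {m L : ℕ}
    {q y : ℤ → ℝ} (hq : ∀ t, q t ∈ Icc 0 (y t)) (hy : ∀ t, y t ≤ 1) (s : ℤ) :
    C.sysTransfer (puncturedErasure ρ₀ ε * backAverage m q s)
        (scParityErasure L (puncturedErasure ρ ε) s)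
      ∈ Icc 0 (clampedComponent C ρ₀ ρ ε' (backAverage m y s)) := by
  have hq' : backAverage m q s ∈ Icc (0 : ℝ) 1 :=
    average_mem_Icc fun k => ⟨(hq _).1, (hq _).2.trans (hy _)⟩
  have hy' : backAverage m y s ∈ Icc (0 : ℝ) 1 :=
    average_mem_Icc fun k => ⟨(hq _).1.trans (hq _).2, hy _⟩
  have hqy : backAverage m q s ≤ backAverage m y s := average_mono fun k => (hq _).2
  have he₀ := puncturedErasure_mem_Icc hρ₀ (Ico_subset_Icc_self hε)
  have he := puncturedErasure_mem_Icc ⟨hρ.1.le, hρ.2⟩ (Ico_subset_Icc_self hε)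
  have hs := scParityErasure_mem_Icc (L := L) he.1 s
  have hs' : scParityErasure L (puncturedErasure ρ ε) s ∈ Icc (0 : ℝ) 1 :=
    ⟨hs.1, hs.2.trans he.2⟩
  have hin := mul_mem_Icc_zero_one he₀ hq'
  refine ⟨(C.sysTransfer_mem_Icc hin hs').1, ?_⟩
  rw [clampedComponent_of_mem C hy']
  -- The known parity bits outside the chain are first replaced by channel outputs; then the channel
  -- parameter and the profile are raised.
  exact (C.sysTransfer_mono hin hs' hin he le_rfl hs.2).trans
    (component_mono C hρ₀ hρ hε hε' hεε' hq' hy' hqy)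

end Clamped

/-- Dropping the right boundary `t ≤ L` only enlarges the profile. This compares the finite chain
with the half-line, uniformly in `L`. -/
theorem scAverage_mem_Icc {m L : ℕ} {p : ℤ → (Fin 2 → ℝ)} {c : Fin 2} {y : ℤ → ℝ}
    (hp : ∀ t, p t c ∈ Icc 0 (y t)) (t : ℤ) :
    scAverage m L p t c ∈ Icc 0 (if 1 ≤ t then frontAverage m y t else 0) := by
  have h0 : 0 ≤ if 1 ≤ t then frontAverage m y t else 0 := by
    split_ifs
    · exact mul_nonneg (one_div_succ_nonneg m)
        (Finset.sum_nonneg fun j _ => (hp _).1.trans (hp _).2)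
    · exact le_rfl
  unfold scAverage
  by_cases h : 1 ≤ t ∧ t ≤ L
  · rw [if_pos h, if_pos h.1]
    exact ⟨mul_nonneg (one_div_succ_nonneg m) (Finset.sum_nonneg fun j _ => (hp _).1),
      average_mono fun j => (hp _).2⟩
  · rw [if_neg h]
    exact ⟨le_rfl, h0⟩

theorem scPccDE_apply_zero (CU CL : RSCEncoder) (ρ₀ ρ₁ ρ₂ : ℝ) (m L : ℕ) (ε : ℝ)
    (p : ℤ → (Fin 2 → ℝ)) (t : ℤ) :
    scPccDE CU CL ρ₀ ρ₁ ρ₂ m L ε p t 0 = CU.sysTransfer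
      (puncturedErasure ρ₀ ε * backAverage m (fun s => scAverage m L p s 1) t)
      (scParityErasure L (puncturedErasure ρ₁ ε) t) := rfl

theorem scPccDE_apply_one (CU CL : RSCEncoder) (ρ₀ ρ₁ ρ₂ : ℝ) (m L : ℕ) (ε : ℝ)
    (p : ℤ → (Fin 2 → ℝ)) (t : ℤ) :
    scPccDE CU CL ρ₀ ρ₁ ρ₂ m L ε p t 1 = CL.sysTransfer
      (puncturedErasure ρ₀ ε * backAverage m (fun s => scAverage m L p s 0) t)
      (scParityErasure L (puncturedErasure ρ₂ ε) t) := rfl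

/-- Threshold saturation: if the potential of the nonzero fixed points of the uncoupled recursion at
a channel parameter `ε'` exceeds `2 / (m + 1)`, then the density evolution of the coupled ensemble
with memory `m` converges to zero for all channel parameters up to `ε'`. -/
theorem tendsto_scPccDE_iterate (CU CL : RSCEncoder) {ρ₀ ρ₁ ρ₂ ε ε' : ℝ}
    (hρ₀ : ρ₀ ∈ Icc (0 : ℝ) 1) (hρ₁ : ρ₁ ∈ Ioc (0 : ℝ) 1) (hρ₂ : ρ₂ ∈ Ioc (0 : ℝ) 1)
    (hε : ε ∈ Ico (0 : ℝ) 1) (hε' : ε' ∈ Ioo (0 : ℝ) 1) (hεε' : ε ≤ ε') {m : ℕ}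
    (hU : ∀ x ∈ nonzeroFixedPoints (pccF CU CL ρ₀ ρ₁ ρ₂) pccG ε',
      2 / ((m : ℝ) + 1) < potential pccG 1 (pccFInt CU CL ρ₀ ρ₁ ρ₂) pccGInt x ε')
    (L : ℕ) {p : ℤ → (Fin 2 → ℝ)} (hp : ∀ t, p t ∈ unitCube 2) (t : ℤ) :
    Tendsto (fun i => (scPccDE CU CL ρ₀ ρ₁ ρ₂ m L ε)^[i] p t) atTop (𝓝 0) := by
  have hε'' : ε' ∈ Ico (0 : ℝ) 1 := Ioo_subset_Ico_self hε'
  set φ := clampedComponent CU ρ₀ ρ₁ ε'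
  set ψ := clampedComponent CL ρ₀ ρ₂ ε'
  have hφ : Monotone φ := clampedComponent_monotone CU hρ₀ hρ₁ hε''
  have hψ : Monotone ψ := clampedComponent_monotone CL hρ₀ hρ₂ hε''
  have hφ1 : ∀ x, φ x ∈ Icc (0 : ℝ) 1 := clampedComponent_mem_Icc CU hρ₀ hρ₁ hε''
  have hψ1 : ∀ x, ψ x ∈ Icc (0 : ℝ) 1 := clampedComponent_mem_Icc CL hρ₀ hρ₂ hε''
  -- Positivity of ε' gives continuity up to z = 1 even for ρ₀ = 0.
  have hφc : Continuous φ := clampedComponent_continuous CU hρ₀ hρ₁ hε'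
  have hψc : Continuous ψ := clampedComponent_continuous CL hρ₀ hρ₂ hε'
  set X : ℕ → (ℤ → ℝ) × (ℤ → ℝ) := fun i => (halfLineMap m φ ψ)^[i] (unitProfile, unitProfile)
  have hprof : ∀ i, IsProfile (X i).1 ∧ IsProfile (X i).2 :=
    isProfile_halfLineMap_iterate hφ hφ1 hψ hψ1
  have hX : ∀ t, Tendsto (fun i => (X i).1 t) atTop (𝓝 0) ∧
      Tendsto (fun i => (X i).2 t) atTop (𝓝 0) := by
    refine tendsto_halfLineMap_iterate hφ hφc hφ1 hψ hψc hψ1 fun α hα β hβ h₁ h₂ h0 => ?_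
    have hfix : ![α, β] ∈ nonzeroFixedPoints (pccF CU CL ρ₀ ρ₁ ρ₂) pccG ε' := by
      refine ⟨RSCEncoder.vec_mem_unitCube hα hβ, fun h => h0 ⟨congrFun h 0, congrFun h 1⟩, ?_⟩
      funext i
      fin_cases i
      · exact (clampedComponent_of_mem CU hβ).symm.trans h₁.symm
      · exact (clampedComponent_of_mem CL hα).symm.trans h₂.symm
    refine (hU _ hfix).trans_le (le_of_eq ?_)
    rw [integral_clampedComponent CU hβ, integral_clampedComponent CL hα]
    simp [potential, pccGInt, pccFInt, pccG, dotProduct]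
    ring
  set P : ℕ → ℤ → (Fin 2 → ℝ) := fun i => (scPccDE CU CL ρ₀ ρ₁ ρ₂ m L ε)^[i] p
  have hPs : ∀ i, P (i + 1) = scPccDE CU CL ρ₀ ρ₁ ρ₂ m L ε (P i) := fun i =>
    Function.iterate_succ_apply' _ _ _
  have hstep : ∀ i, (∀ t, scAverage m L (P i) t 0 ∈ Icc 0 ((X i).1 t)) →
      (∀ t, scAverage m L (P i) t 1 ∈ Icc 0 ((X i).2 t)) →
      (∀ t, P (i + 1) t 0 ∈ Icc 0 (φ (backAverage m (X i).2 t))) ∧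
        ∀ t, P (i + 1) t 1 ∈ Icc 0 (ψ (backAverage m (X i).1 t)) := by
    intro i h0 h1
    refine ⟨fun t => ?_, fun t => ?_⟩
    · rw [hPs, scPccDE_apply_zero]
      exact sysTransfer_backAverage_mem_Icc CU hρ₀ hρ₁ hε hε'' hεε' h1
        (fun t => ((hprof i).2.mem t).2) t
    · rw [hPs, scPccDE_apply_one]
      exact sysTransfer_backAverage_mem_Icc CL hρ₀ hρ₂ hε hε'' hεε' h0
        (fun t => ((hprof i).1.mem t).2) t
  have hbound : ∀ i, (∀ t, scAverage m L (P i) t 0 ∈ Icc 0 ((X i).1 t)) ∧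
      ∀ t, scAverage m L (P i) t 1 ∈ Icc 0 ((X i).2 t) := by
    intro i
    induction i with
    | zero =>
      have h : ∀ c t, scAverage m L p t c ∈ Icc 0 (unitProfile t) := by
        intro c t
        have := scAverage_mem_Icc (m := m) (L := L) (y := fun _ => 1)
          (fun t => mem_unitCube.1 (hp t) c) t
        rwa [frontAverage, average_const] at this
      exact ⟨h 0, h 1⟩
    | succ i ih =>
      obtain ⟨h0, h1⟩ := hstep i ih.1 ih.2
      have hXs : X (i + 1) = halfLineMap m φ ψ (X i) := halfLineMap_iterate_succ m φ ψ _ i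
      rw [hXs]
      exact ⟨scAverage_mem_Icc h0, scAverage_mem_Icc h1⟩
  have hback : ∀ {χ : ℝ → ℝ} {y : ℕ → ℤ → ℝ}, Continuous χ → χ 0 = 0 →
      (∀ t, Tendsto (fun i => y i t) atTop (𝓝 0)) →
      Tendsto (fun i => χ (backAverage m (y i) t)) atTop (𝓝 0) := by
    intro χ y hχ hχ0 hy
    have := tendsto_average (m := m) (f := fun i k => y i (t - k)) (c := fun _ => 0)
      fun k => hy (t - k)
    rw [average_const] at this
    have h := (hχ.tendsto 0).comp this
    rwa [hχ0] at h
  -- The half-line iterates bound the averages; the decoder outputs themselves are bounded one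
  -- iteration later.
  refine (tendsto_add_atTop_iff_nat 1).1 (tendsto_pi_nhds.2 fun c => ?_)
  have hP := fun i => hstep i (hbound i).1 (hbound i).2
  fin_cases c
  · exact squeeze_zero (fun i => ((hP i).1 t).1) (fun i => ((hP i).1 t).2)
      (hback hφc (clampedComponent_zero CU) fun t => (hX t).2)
  · exact squeeze_zero (fun i => ((hP i).2 t).1) (fun i => ((hP i).2 t).2)
      (hback hψc (clampedComponent_zero CL) fun t => (hX t).1)

theorem scPccDE_zero (CU CL : RSCEncoder) (ρ₀ ρ₁ ρ₂ : ℝ) (m L : ℕ) (ε : ℝ) :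
    scPccDE CU CL ρ₀ ρ₁ ρ₂ m L ε 0 = 0 := by
  have h : ∀ t c, scInput m L (puncturedErasure ρ₀ ε) 0 t c = 0 := by
    intro t c
    simp [scInput, scAverage]
  funext t c
  fin_cases c <;> simp [scPccDE, h, RSCEncoder.sysTransfer_zero_left]

theorem tendsto_scAPosteriori {ρ₀ ε : ℝ} {m L : ℕ} {P : ℕ → ℤ → (Fin 2 → ℝ)}
    (hP : ∀ t, Tendsto (fun i => P i t) atTop (𝓝 0)) (t : ℤ) :
    Tendsto (fun i => scAPosteriori ρ₀ m L ε (P i) t) atTop (𝓝 0) := by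
  have h : ∀ c, Tendsto (fun i => scAverage m L (P i) t c) atTop (𝓝 0) := by
    intro c
    unfold scAverage
    split_ifs
    · have := tendsto_average (m := m) (f := fun i j => P i (t + j) c) (c := fun _ => 0)
        fun j => tendsto_pi_nhds.1 (hP (t + j)) c
      rwa [average_const] at this
    · exact tendsto_const_nhds
  simpa [scAPosteriori] using ((h 0).const_mul (puncturedErasure ρ₀ ε)).mul (h 1)

theorem mainTheorem6 (CU CL : RSCEncoder) (ρ₀ ρ₁ ρ₂ : ℝ)
    (hρ₀ : ρ₀ ∈ Set.Icc (0 : ℝ) 1) (hρ₁ : ρ₁ ∈ Set.Ioc (0 : ℝ) 1) (hρ₂ : ρ₂ ∈ Set.Ioc (0 : ℝ) 1) :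
    -- the density evolution recursion is the vector recursion of `f` and `g`
    (∀ (ε : ℝ) (p : Fin 2 → ℝ),
      pccDE CU CL ρ₀ ρ₁ ρ₂ ε p = pccF CU CL ρ₀ ρ₁ ρ₂ (pccG p) ε) ∧
    -- it is a vector admissible system with `D = I`, `G = x₁ x₂` and `F` as above
    IsVectorAdmissible (if 0 < ρ₀ then Set.Ico (0 : ℝ) 1 else Set.Ioo (0 : ℝ) 1)
      (pccF CU CL ρ₀ ρ₁ ρ₂) pccG 1 (pccFInt CU CL ρ₀ ρ₁ ρ₂) pccGInt ∧
    -- the line integral that defines the potential is path independent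
    (∀ ε ∈ Set.Ico (0 : ℝ) 1, ∀ γ : ℝ → (Fin 2 → ℝ),
      ContDiffOn ℝ 1 γ (Set.Icc 0 1) → (∀ t ∈ Set.Icc (0 : ℝ) 1, γ t ∈ unitCube 2) → γ 0 = 0 →
      IntervalIntegrable (potentialIntegrand (pccF CU CL ρ₀ ρ₁ ρ₂) pccG 1 ε γ)
        MeasureTheory.volume 0 1 ∧
      ∫ t in (0 : ℝ)..1, potentialIntegrand (pccF CU CL ρ₀ ρ₁ ρ₂) pccG 1 ε γ t =
        potential pccG 1 (pccFInt CU CL ρ₀ ρ₁ ρ₂) pccGInt (γ 1) ε) ∧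
    -- the density evolution recursion of the coupled ensemble is the coupled vector recursion
    (∀ (m L : ℕ) (ε : ℝ) (p : ℤ → (Fin 2 → ℝ)),
      scAverage m L (scPccDE CU CL ρ₀ ρ₁ ρ₂ m L ε p) =
        coupledStep m L (scPccMap CU CL ρ₀ ρ₁ ρ₂ L ε) pccG (scAverage m L p)) ∧
    -- threshold saturation
    (∀ ε ∈ Set.Ico (0 : ℝ) 1,
      ε < potentialThreshold (Set.Ico (0 : ℝ) 1) (pccF CU CL ρ₀ ρ₁ ρ₂) pccG 1
        (pccFInt CU CL ρ₀ ρ₁ ρ₂) pccGInt →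
      ∃ m₀ : ℕ, ∀ m : ℕ, m₀ ≤ m → ∀ L : ℕ,
        (∀ p : ℤ → (Fin 2 → ℝ), (∀ t, p t ∈ unitCube 2) →
          (scPccDE CU CL ρ₀ ρ₁ ρ₂ m L ε p = p ↔ p = 0)) ∧
        (∀ t : ℤ, Filter.Tendsto (fun i : ℕ => (scPccDE CU CL ρ₀ ρ₁ ρ₂ m L ε)^[i] 1 t)
          Filter.atTop (nhds 0)) ∧
        (∀ t : ℤ, Filter.Tendsto
          (fun i : ℕ => scAPosteriori ρ₀ m L ε ((scPccDE CU CL ρ₀ ρ₁ ρ₂ m L ε)^[i] 1) t)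
          Filter.atTop (nhds 0))) := by
  refine ⟨fun ε p => rfl, isVectorAdmissible_pcc CU CL hρ₀ hρ₁ hρ₂,
    fun ε hε γ hγ hγ1 hγ0 => integral_potentialIntegrand_pcc CU CL hρ₀ hρ₁ hρ₂ hε hγ hγ1 hγ0,
    scAverage_scPccDE CU CL ρ₀ ρ₁ ρ₂, fun ε hε hlt => ?_⟩
  -- The supremum of the empty set is 0, which is not above ε ≥ 0.
  have hne : {ε' | ε' ∈ Ico (0 : ℝ) 1 ∧ 0 < energyGap (pccF CU CL ρ₀ ρ₁ ρ₂) pccG 1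
      (pccFInt CU CL ρ₀ ρ₁ ρ₂) pccGInt ε'}.Nonempty := by
    by_contra h
    rw [potentialThreshold, not_nonempty_iff_eq_empty.1 h, Real.sSup_empty] at hlt
    exact absurd hε.1 (not_le.2 hlt)
  -- The energy gap need not be known to be positive at ε itself. A larger parameter with positive
  -- gap suffices by domination, and it is strictly positive as required for continuity.
  obtain ⟨ε', ⟨hε', hgap⟩, hεε'⟩ := exists_lt_of_lt_csSup hne hlt
  have hε'' : ε' ∈ Ioo (0 : ℝ) 1 := ⟨hε.1.trans_lt hεε', hε'.2⟩
  -- A real δ below the gap covers the case of an infinite gap as well; any m ≥ m₀ > 2/δ gives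
  -- 2/(m+1) < δ.
  obtain ⟨δ, hδ0, hδ⟩ := EReal.lt_iff_exists_real_btwn.1 hgap
  have hδ0' : 0 < δ := EReal.coe_pos.1 hδ0
  obtain ⟨m₀, hm₀⟩ := exists_nat_gt (2 / δ)
  refine ⟨m₀, fun m hm L => ?_⟩
  have hU : ∀ x ∈ nonzeroFixedPoints (pccF CU CL ρ₀ ρ₁ ρ₂) pccG ε',
      2 / ((m : ℝ) + 1) < potential pccG 1 (pccFInt CU CL ρ₀ ρ₁ ρ₂) pccGInt x ε' := by
    intro x hx
    have h₁ : δ < potential pccG 1 (pccFInt CU CL ρ₀ ρ₁ ρ₂) pccGInt x ε' :=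
      EReal.coe_lt_coe_iff.1 (hδ.trans_le (iInf₂_le x hx))
    have h₂ : (m₀ : ℝ) ≤ m := Nat.cast_le.2 hm
    refine lt_trans ?_ h₁
    rw [div_lt_iff₀ hδ0'] at hm₀
    rw [div_lt_iff₀ (by positivity)]
    nlinarith
  have hconv : ∀ p : ℤ → (Fin 2 → ℝ), (∀ t, p t ∈ unitCube 2) → ∀ t, Tendsto
      (fun i => (scPccDE CU CL ρ₀ ρ₁ ρ₂ m L ε)^[i] p t) atTop (𝓝 0) := fun p hp =>
    tendsto_scPccDE_iterate CU CL hρ₀ hρ₁ hρ₂ hε hε'' hεε'.le hU L hp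
  have hone : ∀ t : ℤ, (1 : ℤ → (Fin 2 → ℝ)) t ∈ unitCube 2 := fun t =>
    mem_unitCube.2 fun i => right_mem_Icc.2 zero_le_one
  refine ⟨fun p hp => ⟨fun h => ?_, fun h => ?_⟩, hconv 1 hone,
    tendsto_scAPosteriori (hconv 1 hone)⟩
  -- Convergence to 0 holds from every start in the cube, and the iteration is constant at a fixed
  -- point.
  · funext t
    have := hconv p hp t
    simp only [Function.iterate_fixed h] at this
    exact tendsto_nhds_unique tendsto_const_nhds this
  · rw [h, scPccDE_zero]
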